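/- Let $(M,g)$ be a smooth Riemannian manifold (without boundary, not necessarily compact) of even dimension $n=2r$, and let $k$ be an integer with $2\le 2k\le r$. In the bundle of algebras $\Lambda T^*M\otimes\Lambda T^*M$ of double forms, whose product (the exterior product) is given by $(\theta_1\otimes\theta_2)(\theta_3\otimes\theta_4)=(\theta_1\wedge\theta_3)\otimes(\theta_2\wedge\theta_4)$, regard $g$ as a $(1,1)$ double form and the Riemann curvature tensor $R$ as a $(2,2)$ double form, and let powers and products such as $R^k$ and $g^{r-2k}R^k$ be taken in this algebra. Let $\star$ be the double Hodge star operator, $\star\omega=\iota_\omega\frac{g^n}{n!}$, where the interior product $\iota_\omega$ is the adjoint of the left exterior multiplication by $\omega$; equivalently, for a local orientation, $\star(\theta_1\otimes\theta_2)=\star\theta_1\otimes\star\theta_2$. The metric $g$ is called $(2k)$-Thorpe if $\star(g^{r-2k}R^k)=g^{r-2k}R^k$ on $M$, and $(2k)$-anti-Thorpe if $\star(g^{r-2k}R^k)=-g^{r-2k}R^k$ on $M$. If $g$ is $(2k)$-Thorpe or $(2k)$-anti-Thorpe, then the $(2k,2k)$ double form $R^k$ is harmonic, that is, closed and coclosed: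 $DR^k=0$ and $\delta R^k=0$. Here, for the Levi-Civita connection $\nabla$ and a local frame $(e_i)$ with dual coframe $(e^i)$, $D\omega=\sum_j (e^j\otimes 1)\,\nabla_{e_j}\omega$ is the second Bianchi sum, and $\delta\omega=-\sum_{i,j}g^{ij}\,(\iota_{e_i}\otimes 1)\nabla_{e_j}\omega$ is the divergence with respect to the first factor (the formal adjoint of $D$). -/

import Mathlib

open scoped Manifold ContDiff TensorProduct

noncomputable section

namespace ThorpeGeometry

/-! ### Double forms

Let `V` be an `n`-dimensional real vector space with basis `∂_0, …, ∂_{n-1}`. Its dual `V*` is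
identified with `Fin n → ℝ` by means of the dual basis `dx^0, …, dx^{n-1}`. -/

/-- The exterior algebra `Λ V*`. -/
abbrev Forms (n : ℕ) : Type := ExteriorAlgebra ℝ (Fin n → ℝ)

/-- The double exterior algebra `Λ V* ⊗ Λ V*`. Its product is the one of the (ungraded) tensor
product of algebras, `(a ⊗ b) * (c ⊗ d) = (a ∧ c) ⊗ (b ∧ d)`: the exterior product of double
forms. -/
abbrev DoubleForm (n : ℕ) : Type := Forms n ⊗[ℝ] Forms n

variable {n : ℕ}

/-- The coordinate one-form `dx^i`. -/
def dx (i : Fin n) : Forms n := ExteriorAlgebra.ι ℝ (Pi.single i 1)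

/-- The interior product of ordinary forms with the coordinate vector `∂_i`
(the antiderivation with `dx^j ↦ δ_i^j`). -/
def contr (i : Fin n) : Forms n →ₗ[ℝ] Forms n :=
  CliffordAlgebra.contractLeft (Q := (0 : QuadraticForm ℝ (Fin n → ℝ))) (LinearMap.proj i)

/-- The basis `dx^I ⊗ dx^J` of the space of double forms, where `I`, `J` are sets of indices and
`dx^I = dx^{i_1} ∧ … ∧ dx^{i_p}` for `I = {i_1 < … < i_p}`. -/
def doubleFormBasis (n : ℕ) : Module.Basis (Finset (Fin n) × Finset (Fin n)) ℝ (DoubleForm n) :=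
  ((Pi.basisFun ℝ (Fin n)).ExteriorAlgebra).tensorProduct
    ((Pi.basisFun ℝ (Fin n)).ExteriorAlgebra)

/-- The inner product with matrix `G = (g_ij)` as a `(1,1)` double form,
`g = ∑ g_ij dx^i ⊗ dx^j`. -/
def metricForm (G : Matrix (Fin n) (Fin n) ℝ) : DoubleForm n :=
  ∑ i, ∑ j, G i j • (dx i ⊗ₜ[ℝ] dx j)

/-! ### Interior product and Hodge star for an inner product with matrix `G` on `V` -/

/-- The interior product with the vector `θ^♯` metrically dual to the covector `θ`, that is,
`∑ g^{ij} θ_i ι_{∂_j}`; it is the adjoint of the left wedge multiplication by `θ`. -/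
def sharpContr (G : Matrix (Fin n) (Fin n) ℝ) : (Fin n → ℝ) →ₗ[ℝ] (Module.End ℝ (Forms n))ᵐᵒᵖ :=
  (MulOpposite.opLinearEquiv ℝ : Module.End ℝ (Forms n) ≃ₗ[ℝ] _).toLinearMap ∘ₗ
    (CliffordAlgebra.contractLeft (Q := (0 : QuadraticForm ℝ (Fin n → ℝ)))) ∘ₗ
      (Matrix.toLinearMap₂' ℝ G⁻¹)

theorem sharpContr_mul_self (G : Matrix (Fin n) (Fin n) ℝ) (θ : Fin n → ℝ) :
    sharpContr G θ * sharpContr G θ = 0 := by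
  apply MulOpposite.unop_injective
  exact LinearMap.ext fun x => CliffordAlgebra.contractLeft_contractLeft _ x

/-- The interior product `ι_θ` of ordinary forms by a form `θ`, the adjoint of left wedge
multiplication by `θ`. As taking adjoints reverses products, one has `ι_{θ ∧ η} = ι_η ∘ ι_θ`,
which with its values on one-forms (and `ι_1 = id`) determines it. -/
def interiorForm (G : Matrix (Fin n) (Fin n) ℝ) : Forms n →ₗ[ℝ] Module.End ℝ (Forms n) :=
  (MulOpposite.opLinearEquiv ℝ : Module.End ℝ (Forms n) ≃ₗ[ℝ] _).symm.toLinearMap ∘ₗ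
    (ExteriorAlgebra.lift ℝ ⟨sharpContr G, sharpContr_mul_self G⟩).toLinearMap

/-- The interior product `ι_α` of double forms by a double form `α`, the adjoint of the left
exterior multiplication by `α`; it satisfies `ι_{θ₁ ⊗ θ₂} = ι_{θ₁} ⊗ ι_{θ₂}`. -/
def interior (G : Matrix (Fin n) (Fin n) ℝ) : DoubleForm n →ₗ[ℝ] Module.End ℝ (DoubleForm n) :=
  (TensorProduct.homTensorHomMap (.id ℝ) (Forms n) (Forms n) (Forms n) (Forms n)) ∘ₗ
    TensorProduct.map (interiorForm G) (interiorForm G)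

/-- The (double) Hodge star operator `⋆α = ι_α (g^n / n!)`. -/
def hodgeStar (G : Matrix (Fin n) (Fin n) ℝ) (α : DoubleForm n) : DoubleForm n :=
  interior G α ((n.factorial : ℝ)⁻¹ • metricForm G ^ n)

/-! ### Local Riemannian geometry

`G y` is the matrix of a Riemannian metric at the point `y` of an open set of `ℝⁿ`. -/

/-- The partial derivative `∂_i f (y)`. -/
def pderiv (i : Fin n) (f : EuclideanSpace ℝ (Fin n) → ℝ) (y : EuclideanSpace ℝ (Fin n)) : ℝ :=
  fderiv ℝ f y (EuclideanSpace.single i 1)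

/-- The Christoffel symbol
`Γ^k_ij = ½ ∑_l g^{kl} (∂_i g_jl + ∂_j g_il - ∂_l g_ij)` of the Levi-Civita connection. -/
def christoffel (G : EuclideanSpace ℝ (Fin n) → Matrix (Fin n) (Fin n) ℝ) (k i j : Fin n)
    (y : EuclideanSpace ℝ (Fin n)) : ℝ :=
  (1 / 2 : ℝ) * ∑ l, (G y)⁻¹ k l *
    (pderiv i (fun z => G z j l) y + pderiv j (fun z => G z i l) y - pderiv l (fun z => G z i j) y)

/-- The components `R^l_{kij}` of the curvature, `R(∂_i, ∂_j) ∂_k = ∑_l R^l_{kij} ∂_l`, where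
`R(X, Y) = [∇_X, ∇_Y] - ∇_{[X,Y]}`. -/
def curvatureUp (G : EuclideanSpace ℝ (Fin n) → Matrix (Fin n) (Fin n) ℝ) (l k i j : Fin n)
    (y : EuclideanSpace ℝ (Fin n)) : ℝ :=
  pderiv i (christoffel G l j k) y - pderiv j (christoffel G l i k) y
    + ∑ m, (christoffel G l i m y * christoffel G m j k y
      - christoffel G l j m y * christoffel G m i k y)

/-- The components `R_ijkl = g(R(∂_i, ∂_j) ∂_l, ∂_k)` of the covariant curvature tensor, with the
sign for which `R(X, Y, X, Y)` is the sectional curvature when `X`, `Y` are orthonormal. -/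
def curvatureDown (G : EuclideanSpace ℝ (Fin n) → Matrix (Fin n) (Fin n) ℝ) (i j k l : Fin n)
    (y : EuclideanSpace ℝ (Fin n)) : ℝ :=
  ∑ m, G y k m * curvatureUp G m l i j y

/-- The Riemann curvature tensor as a `(2,2)` double form,
`R = ∑_{i<j, k<l} R_ijkl (dx^i ∧ dx^j) ⊗ (dx^k ∧ dx^l)`. -/
def curvatureForm (G : EuclideanSpace ℝ (Fin n) → Matrix (Fin n) (Fin n) ℝ)
    (y : EuclideanSpace ℝ (Fin n)) : DoubleForm n :=
  (1 / 4 : ℝ) • ∑ i, ∑ j, ∑ k, ∑ l,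
    curvatureDown G i j k l y • ((dx i * dx j) ⊗ₜ[ℝ] (dx k * dx l))

/-- The partial derivative `∂_i α (y)` of a field of double forms, taken coefficientwise. -/
def partialForm (i : Fin n) (α : EuclideanSpace ℝ (Fin n) → DoubleForm n)
    (y : EuclideanSpace ℝ (Fin n)) : DoubleForm n :=
  ∑ b, pderiv i (fun z => (doubleFormBasis n).repr (α z) b) y • doubleFormBasis n b

/-- The derivation `∑_{k,l} Γ^k_jl dx^l ∧ ι_{∂_k}` of `Λ V*`, which sends `dx^k` to
`∑_l Γ^k_jl dx^l = -∇_{∂_j} dx^k`. -/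
def connectionForms (G : EuclideanSpace ℝ (Fin n) → Matrix (Fin n) (Fin n) ℝ) (j : Fin n)
    (y : EuclideanSpace ℝ (Fin n)) : Forms n →ₗ[ℝ] Forms n :=
  ∑ k, ∑ l, christoffel G k j l y • (LinearMap.mulLeft ℝ (dx l) ∘ₗ contr k)

/-- The covariant derivative `∇_{∂_j} α` of a field of double forms with respect to the
Levi-Civita connection. -/
def covDeriv (G : EuclideanSpace ℝ (Fin n) → Matrix (Fin n) (Fin n) ℝ) (j : Fin n)
    (α : EuclideanSpace ℝ (Fin n) → DoubleForm n) (y : EuclideanSpace ℝ (Fin n)) : DoubleForm n :=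
  partialForm j α y
    - (LinearMap.rTensor (Forms n) (connectionForms G j y) (α y)
      + LinearMap.lTensor (Forms n) (connectionForms G j y) (α y))

/-- The second Bianchi sum (exterior covariant derivative in the first factor)
`D α = ∑_j dx^j ∧ ∇_{∂_j} α`, mapping `(p,q)` to `(p+1,q)` double forms. -/
def bianchiSum (G : EuclideanSpace ℝ (Fin n) → Matrix (Fin n) (Fin n) ℝ)
    (α : EuclideanSpace ℝ (Fin n) → DoubleForm n) (y : EuclideanSpace ℝ (Fin n)) : DoubleForm n :=
  ∑ j, (dx j ⊗ₜ[ℝ] (1 : Forms n)) * covDeriv G j α y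

/-- The codifferential (divergence in the first factor, formal adjoint of `D`)
`δ α = -∑ g^{ij} ι_{∂_i} ∇_{∂_j} α`, mapping `(p,q)` to `(p-1,q)` double forms. -/
def codiff (G : EuclideanSpace ℝ (Fin n) → Matrix (Fin n) (Fin n) ℝ)
    (α : EuclideanSpace ℝ (Fin n) → DoubleForm n) (y : EuclideanSpace ℝ (Fin n)) : DoubleForm n :=
  -∑ i, ∑ j, (G y)⁻¹ i j • LinearMap.rTensor (Forms n) (contr i) (covDeriv G j α y)

/-! ### Riemannian manifolds -/

variable {M : Type*} [TopologicalSpace M] [ChartedSpace (EuclideanSpace ℝ (Fin n)) M]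
  [IsManifold (𝓡 n) ∞ M]

/-- A smooth Riemannian metric on the smooth `n`-manifold `M`. -/
abbrev RiemMetric (n : ℕ) (M : Type*) [TopologicalSpace M]
    [ChartedSpace (EuclideanSpace ℝ (Fin n)) M] [IsManifold (𝓡 n) ∞ M] : Type _ :=
  Bundle.ContMDiffRiemannianMetric (𝓡 n) ∞ (EuclideanSpace ℝ (Fin n))
    (fun x : M => TangentSpace (𝓡 n) x)

/-- The matrix `g_ij = g(∂_i, ∂_j)` of the metric in the chart `φ`, as a function on the target
of `φ`, where `∂_i` is the image of the `i`-th standard vector under the differential of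
`φ⁻¹`. -/
def gram (g : RiemMetric n M) (φ : OpenPartialHomeomorph M (EuclideanSpace ℝ (Fin n)))
    (y : EuclideanSpace ℝ (Fin n)) : Matrix (Fin n) (Fin n) ℝ :=
  fun i j => g.inner (φ.symm y)
    (mfderiv (𝓡 n) (𝓡 n) φ.symm y (EuclideanSpace.single i (1 : ℝ)))
    (mfderiv (𝓡 n) (𝓡 n) φ.symm y (EuclideanSpace.single j (1 : ℝ)))

/-- The Thorpe tensor `R^k`, the `k`-th exterior power of the Riemann curvature tensor, expressed
in the chart `φ`. -/
def thorpeTensor (g : RiemMetric n M) (k : ℕ)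
    (φ : OpenPartialHomeomorph M (EuclideanSpace ℝ (Fin n))) (y : EuclideanSpace ℝ (Fin n)) :
    DoubleForm n :=
  curvatureForm (gram g φ) y ^ k

/-- For `n = 2r`, the metric is `(2k)`-Thorpe: `⋆(g^{r-2k} R^k) = g^{r-2k} R^k`. An identity
between tensor fields is expressed by its validity in all charts of the smooth structure. -/
def IsThorpe (g : RiemMetric n M) (r k : ℕ) : Prop :=
  ∀ φ ∈ IsManifold.maximalAtlas (𝓡 n) ∞ M, ∀ y ∈ φ.target,
    hodgeStar (gram g φ y) (metricForm (gram g φ y) ^ (r - 2 * k) * thorpeTensor g k φ y)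
      = metricForm (gram g φ y) ^ (r - 2 * k) * thorpeTensor g k φ y

/-- For `n = 2r`, the metric is `(2k)`-anti-Thorpe: `⋆(g^{r-2k} R^k) = -g^{r-2k} R^k`. -/
def IsAntiThorpe (g : RiemMetric n M) (r k : ℕ) : Prop :=
  ∀ φ ∈ IsManifold.maximalAtlas (𝓡 n) ∞ M, ∀ y ∈ φ.target,
    hodgeStar (gram g φ y) (metricForm (gram g φ y) ^ (r - 2 * k) * thorpeTensor g k φ y)
      = -(metricForm (gram g φ y) ^ (r - 2 * k) * thorpeTensor g k φ y)

/-- A field `α` of double forms, given by its expressions in the charts of the smooth structure,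
is harmonic: it is closed, `D α = 0`, and coclosed, `δ α = 0`. -/
def IsHarmonic (g : RiemMetric n M)
    (α : OpenPartialHomeomorph M (EuclideanSpace ℝ (Fin n)) →
      EuclideanSpace ℝ (Fin n) → DoubleForm n) : Prop :=
  ∀ φ ∈ IsManifold.maximalAtlas (𝓡 n) ∞ M, ∀ y ∈ φ.target,
    bianchiSum (gram g φ) (α φ) y = 0 ∧ codiff (gram g φ) (α φ) y = 0

end ThorpeGeometry

end

/-!
The Riemann curvature tensor `R` satisfies the second Bianchi identity, hence `D R = 0`. As `D` is
a derivation up to sign and `R` commutes with one-forms of either factor, `D R^k = 0` for every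
metric; the pair symmetry of `R` gives the same for the exterior derivative `D̃` in the second
factor. This is `HasClosedCovDeriv.exists_pow_curvatureForm`. Only the coclosedness of `R^k` uses
the (anti-)Thorpe condition.

The Hodge star is parallel (`IsLocalMetric.hasCovDeriv_hodgeStar`) and `ι_θ ⋆β = ⋆(β ∧ θ)`, since
`ι_{β ∧ θ} = ι_θ ι_β`. Hence `δ ⋆α = 0` whenever `D α = 0` (`divergence_hodgeStar`). The form
`α = g^m R^k` with `m = r - 2k` is closed because `g` is parallel, so `⋆α = ±α` gives
`δ(g^m R^k) = 0`. Contracting the factor `g` yields `δ(g α) = -D̃ α - g δα`, so that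
`δ(g^m R^k) = ± g^m δ R^k` (`divergence_metricForm_pow_mul`) and therefore `g^m δ R^k = 0`.

Finally `δ R^k` has bidegree `(2k - 1, 2k)`, and multiplication by `g^m` is injective on
bidegree `(p, q)` if `p + q + m ≤ n` (`eq_zero_of_metricForm_pow_mul_eq_zero`). This follows, as in
the Lefschetz decomposition, from the `sl₂` relation between the multiplication by `g`, the
contraction `c = ∑ g^{ij} ι_{∂_i} ⊗ ι_{∂_j}` and the degree operator
(`metricContraction_metricForm_mul`): `g^m x = 0` implies `g^{m+1} (c x) = 0`, so `c x = 0` by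
induction on `p`, and then `g^{m-1} x = 0`. Here `p + q + m = 2k - 1 + r ≤ n`.

All tensors are expressed in a chart `φ`. The metric matrix is smooth, symmetric and invertible on
the target of `φ` (`IsLocalMetric`), and derivatives of fields with values in finite-dimensional
spaces are tested on linear functionals (`HasPartial`).
-/

noncomputable section

namespace ThorpeGeometry

variable {n : ℕ}

/-! ### Partial derivatives of vector-valued fields -/

section HasPartial

variable {U V W : Type*} [AddCommGroup U] [Module ℝ U] [AddCommGroup V] [Module ℝ V]
  [AddCommGroup W] [Module ℝ W]

/-- The field `f`, with values in a real vector space without a chosen topology, has the partial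
derivative `f'` in the direction `∂_j` at `y`. The derivative is tested on linear functionals, so
that no norm on spaces such as `DoubleForm n` is needed; on a finite-dimensional space this is the
coefficientwise derivative in any basis. -/
def HasPartial (j : Fin n) (f : EuclideanSpace ℝ (Fin n) → U) (f' : U)
    (y : EuclideanSpace ℝ (Fin n)) : Prop :=
  ∀ ℓ : U →ₗ[ℝ] ℝ, DifferentiableAt ℝ (fun z => ℓ (f z)) y ∧ pderiv j (fun z => ℓ (f z)) y = ℓ f'

variable {j : Fin n} {y : EuclideanSpace ℝ (Fin n)}

theorem hasPartial_real {f : EuclideanSpace ℝ (Fin n) → ℝ} (hf : DifferentiableAt ℝ f y) :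
    HasPartial j f (pderiv j f y) y := by
  intro ℓ
  have hℓ : ∀ x, ℓ x = ℓ 1 * x := fun x => by
    conv_lhs => rw [← mul_one x, ← smul_eq_mul, map_smul, smul_eq_mul, mul_comm]
  rw [hℓ (pderiv j f y), funext fun z => hℓ (f z)]
  exact ⟨hf.const_mul _, by rw [pderiv, fderiv_const_mul hf]; rfl⟩

namespace HasPartial

theorem comp_linear {f : EuclideanSpace ℝ (Fin n) → U} {f' : U} (h : HasPartial j f f' y)
    (L : U →ₗ[ℝ] V) : HasPartial j (fun z => L (f z)) (L f') y :=
  fun ℓ => h (ℓ ∘ₗ L)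

theorem const (u : U) : HasPartial j (fun _ => u) 0 y := fun ℓ => by
  simp [pderiv]

theorem add {f g : EuclideanSpace ℝ (Fin n) → U} {f' g' : U} (hf : HasPartial j f f' y)
    (hg : HasPartial j g g' y) : HasPartial j (fun z => f z + g z) (f' + g') y := fun ℓ => by
  simp only [map_add, pderiv, ← (hf ℓ).2, ← (hg ℓ).2]
  exact ⟨(hf ℓ).1.add (hg ℓ).1, by rw [fderiv_fun_add (hf ℓ).1 (hg ℓ).1]; rfl⟩

theorem sum {ι : Type*} (s : Finset ι) {f : ι → EuclideanSpace ℝ (Fin n) → U} {f' : ι → U}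
    (h : ∀ i ∈ s, HasPartial j (f i) (f' i) y) :
    HasPartial j (fun z => ∑ i ∈ s, f i z) (∑ i ∈ s, f' i) y := by
  classical
  induction s using Finset.induction_on with
  | empty => simpa using const 0
  | insert a s ha ih =>
    simp only [Finset.sum_insert ha]
    exact (h a (Finset.mem_insert_self a s)).add
      (ih fun i hi => h i (Finset.mem_insert_of_mem hi))

theorem neg {f : EuclideanSpace ℝ (Fin n) → U} {f' : U} (hf : HasPartial j f f' y) :
    HasPartial j (fun z => -f z) (-f') y := by
  simpa using hf.comp_linear (-LinearMap.id)

theorem sub {f g : EuclideanSpace ℝ (Fin n) → U} {f' g' : U} (hf : HasPartial j f f' y)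
    (hg : HasPartial j g g' y) : HasPartial j (fun z => f z - g z) (f' - g') y := by
  simpa only [sub_eq_add_neg] using hf.add hg.neg

theorem differentiableAt {f : EuclideanSpace ℝ (Fin n) → ℝ} {f' : ℝ} (h : HasPartial j f f' y) :
    DifferentiableAt ℝ f y := (h LinearMap.id).1

theorem pderiv_eq {f : EuclideanSpace ℝ (Fin n) → ℝ} {f' : ℝ} (h : HasPartial j f f' y) :
    pderiv j f y = f' := (h LinearMap.id).2

theorem smul {c : EuclideanSpace ℝ (Fin n) → ℝ} {c' : ℝ} {f : EuclideanSpace ℝ (Fin n) → U}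
    {f' : U} (hc : HasPartial j c c' y) (hf : HasPartial j f f' y) :
    HasPartial j (fun z => c z • f z) (c' • f y + c y • f') y := fun ℓ => by
  simp only [map_smul, map_add, smul_eq_mul, ← (hf ℓ).2, ← hc.pderiv_eq, pderiv]
  refine ⟨hc.differentiableAt.mul (hf ℓ).1, ?_⟩
  rw [fderiv_fun_mul hc.differentiableAt (hf ℓ).1]
  simp only [add_apply, smul_apply, smul_eq_mul]
  ring

theorem congr_of_eventuallyEq {f g : EuclideanSpace ℝ (Fin n) → U} {f' : U}
    (h : HasPartial j f f' y) (hfg : g =ᶠ[nhds y] f) : HasPartial j g f' y := fun ℓ => by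
  have : (fun z => ℓ (g z)) =ᶠ[nhds y] fun z => ℓ (f z) := hfg.fun_comp ℓ
  refine ⟨(h ℓ).1.congr_of_eventuallyEq this, ?_⟩
  rw [← (h ℓ).2, pderiv, this.fderiv_eq, pderiv]

theorem of_eq {f : EuclideanSpace ℝ (Fin n) → U} {a b : U} (h : HasPartial j f b y)
    (hab : a = b) : HasPartial j f a y := hab ▸ h

theorem unique {f : EuclideanSpace ℝ (Fin n) → U} {a b : U}
    (ha : HasPartial j f a y) (hb : HasPartial j f b y) : a = b := by
  rw [← sub_eq_zero, ← Module.forall_dual_apply_eq_zero_iff ℝ]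
  intro ℓ
  rw [map_sub, ← (ha ℓ).2, ← (hb ℓ).2, sub_self]

/-- The Leibniz rule for a bilinear map. -/
theorem bilin [Module.Finite ℝ U] (B : U →ₗ[ℝ] V →ₗ[ℝ] W) {f : EuclideanSpace ℝ (Fin n) → U}
    {g : EuclideanSpace ℝ (Fin n) → V} {f' : U} {g' : V} (hf : HasPartial j f f' y)
    (hg : HasPartial j g g' y) :
    HasPartial j (fun z => B (f z) (g z)) (B f' (g y) + B (f y) g') y := by
  -- expanding the first argument in a basis reduces the claim to the product rule for `smul`
  let b := Module.finBasis ℝ U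
  have hB : ∀ u v, B u v = ∑ i, b.repr u i • B (b i) v := fun u v => by
    conv_lhs => rw [← b.sum_repr u]
    simp only [map_sum, map_smul, LinearMap.sum_apply, LinearMap.smul_apply]
  rw [hB f' (g y), hB (f y) g', funext fun z => hB (f z) (g z)]
  rw [← Finset.sum_add_distrib]
  exact sum _ fun i _ => (hf.comp_linear (b.coord i)).smul (hg.comp_linear (B (b i)))

theorem mul {A : Type*} [Ring A] [Algebra ℝ A] [Module.Finite ℝ A]
    {f g : EuclideanSpace ℝ (Fin n) → A} {f' g' : A} (hf : HasPartial j f f' y)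
    (hg : HasPartial j g g' y) :
    HasPartial j (fun z => f z * g z) (f' * g y + f y * g') y :=
  hf.bilin (LinearMap.mul ℝ A) hg

/-- The partial derivative of a field with values in a subspace lies in that subspace. -/
theorem mem {f : EuclideanSpace ℝ (Fin n) → U} {f' : U} (h : HasPartial j f f' y)
    {S : Submodule ℝ U} (hS : ∀ᶠ z in nhds y, f z ∈ S) : f' ∈ S := by
  rw [← S.ker_mkQ, LinearMap.mem_ker]
  refine (h.comp_linear S.mkQ).unique ((const (0 : U ⧸ S)).congr_of_eventuallyEq ?_)
  filter_upwards [hS] with z hz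
  simpa using hz

end HasPartial

/-- Differentiability of the coefficients in a basis suffices. -/
theorem hasPartial_of_basis {ι : Type*} [Fintype ι] (b : Module.Basis ι ℝ U)
    {f : EuclideanSpace ℝ (Fin n) → U} (h : ∀ i, DifferentiableAt ℝ (fun z => b.repr (f z) i) y) :
    HasPartial j f (∑ i, pderiv j (fun z => b.repr (f z) i) y • b i) y := by
  have := HasPartial.sum Finset.univ (fun i _ =>
    ((hasPartial_real (h i) : HasPartial j _ _ y)).comp_linear
      (LinearMap.toSpanSingleton ℝ U (b i)))
  simpa [b.sum_repr] using this

theorem hasPartial_matrix {m p : Type*} [Fintype m] [Fintype p] [DecidableEq m] [DecidableEq p]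
    {A : EuclideanSpace ℝ (Fin n) → Matrix m p ℝ}
    (h : ∀ a b, DifferentiableAt ℝ (fun z => A z a b) y) :
    HasPartial j A (Matrix.of fun a b => pderiv j (fun z => A z a b) y) y := by
  have hrepr : ∀ (B : Matrix m p ℝ) i, (Matrix.stdBasis ℝ m p).repr B i = B i.1 i.2 :=
    fun _ _ => rfl
  have := hasPartial_of_basis (j := j) (y := y) (Matrix.stdBasis ℝ m p) (f := A)
    (fun i => by simpa only [hrepr] using h i.1 i.2)
  convert this using 1
  ext a b
  simp [Matrix.sum_apply, Matrix.stdBasis_eq_single, Matrix.single_apply, Fintype.sum_prod_type,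
    hrepr, ite_and]

instance : Module.Finite ℝ (Forms n) := .of_basis (Pi.basisFun ℝ (Fin n)).ExteriorAlgebra

theorem HasPartial.partialForm_eq {α : EuclideanSpace ℝ (Fin n) → DoubleForm n} {α' : DoubleForm n}
    (h : HasPartial j α α' y) : partialForm j α y = α' := by
  refine (hasPartial_of_basis (doubleFormBasis n) fun b => ?_).unique h
  exact (h.comp_linear ((doubleFormBasis n).coord b)).differentiableAt

end HasPartial

/-! ### Derivations of the exterior algebra induced by matrices -/

theorem eq_zero_of_eq_neg_real {V : Type*} [AddCommGroup V] [Module ℝ V] {x : V} (h : x = -x) :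
    x = 0 := by
  have h2 : (2 : ℝ) • x = 0 := by rw [two_smul, ← eq_neg_iff_add_eq_zero]; exact h
  simpa using h2

theorem contr_ι_mul (k : Fin n) (v : Fin n → ℝ) (b : Forms n) :
    contr k (ExteriorAlgebra.ι ℝ v * b) = v k • b - ExteriorAlgebra.ι ℝ v * contr k b :=
  CliffordAlgebra.contractLeft_ι_mul _ _ _

theorem contr_one (k : Fin n) : contr k (1 : Forms n) = 0 := CliffordAlgebra.contractLeft_one _ _

theorem contr_comm (k l : Fin n) (x : Forms n) : contr k (contr l x) = -contr l (contr k x) :=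
  CliffordAlgebra.contractLeft_comm _ _ _

theorem contr_dx_mul (k l : Fin n) (b : Forms n) :
    contr k (dx l * b) = (if k = l then b else 0) - dx l * contr k b := by
  rw [dx, contr_ι_mul, Pi.single_apply, ite_smul, one_smul, zero_smul]

theorem contr_ι (k : Fin n) (v : Fin n → ℝ) :
    contr k (ExteriorAlgebra.ι ℝ v) = algebraMap ℝ _ (v k) := CliffordAlgebra.contractLeft_ι _ _ _

theorem dx_mul_dx_comm (i j : Fin n) : dx i * dx j = -(dx j * dx i) :=
  eq_neg_of_add_eq_zero_left (ExteriorAlgebra.ι_add_mul_swap _ _)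

theorem ι_eq_sum_dx (v : Fin n → ℝ) : ExteriorAlgebra.ι ℝ v = ∑ i, v i • dx i := by
  conv_lhs => rw [← (Pi.basisFun ℝ (Fin n)).sum_repr v]
  simp [dx]

/-- The derivation `∑_{k,l} A_kl dx^l ∧ ι_{∂_k}` of `Λ V*` extending the linear map
`dx^k ↦ ∑_l A_kl dx^l`. -/
def matrixDerivation (A : Matrix (Fin n) (Fin n) ℝ) : Forms n →ₗ[ℝ] Forms n :=
  ∑ k, ∑ l, A k l • (LinearMap.mulLeft ℝ (dx l) ∘ₗ contr k)

theorem matrixDerivation_apply (A : Matrix (Fin n) (Fin n) ℝ) (x : Forms n) :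
    matrixDerivation A x = ∑ k, ∑ l, A k l • (dx l * contr k x) := by
  simp [matrixDerivation]

theorem matrixDerivation_one (A : Matrix (Fin n) (Fin n) ℝ) : matrixDerivation A 1 = 0 := by
  simp [matrixDerivation_apply, contr_one]

theorem matrixDerivation_algebraMap (A : Matrix (Fin n) (Fin n) ℝ) (r : ℝ) :
    matrixDerivation A (algebraMap ℝ _ r) = 0 := by
  rw [Algebra.algebraMap_eq_smul_one, map_smul, matrixDerivation_one, smul_zero]

theorem matrixDerivation_ι (A : Matrix (Fin n) (Fin n) ℝ) (v : Fin n → ℝ) :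
    matrixDerivation A (ExteriorAlgebra.ι ℝ v) = ∑ k, ∑ l, (A k l * v k) • dx l := by
  simp only [matrixDerivation_apply, contr_ι, Algebra.algebraMap_eq_smul_one, mul_smul_comm,
    mul_one, smul_smul]

theorem matrixDerivation_dx (A : Matrix (Fin n) (Fin n) ℝ) (i : Fin n) :
    matrixDerivation A (dx i) = ∑ l, A i l • dx l := by
  rw [dx, matrixDerivation_ι, Finset.sum_eq_single i (fun k _ hk => by simp [hk]) (by simp)]
  simp

theorem matrixDerivation_ι_mul (A : Matrix (Fin n) (Fin n) ℝ) (v : Fin n → ℝ) (b : Forms n) :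
    matrixDerivation A (ExteriorAlgebra.ι ℝ v * b) =
      matrixDerivation A (ExteriorAlgebra.ι ℝ v) * b
        + ExteriorAlgebra.ι ℝ v * matrixDerivation A b := by
  rw [matrixDerivation_ι]
  simp only [matrixDerivation_apply, Finset.sum_mul, Finset.mul_sum, ← Finset.sum_add_distrib]
  refine Finset.sum_congr rfl fun k _ => Finset.sum_congr rfl fun l _ => ?_
  have : dx l * (ExteriorAlgebra.ι ℝ v * contr k b)
      = -(ExteriorAlgebra.ι ℝ v * (dx l * contr k b)) := by
    rw [← mul_assoc, ← mul_assoc, ← neg_mul]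
    exact congrArg (· * _) (eq_neg_of_add_eq_zero_left (ExteriorAlgebra.ι_add_mul_swap _ _))
  rw [contr_ι_mul, mul_sub, this, sub_neg_eq_add, smul_add, mul_smul_comm, mul_smul_comm,
    smul_mul_assoc, smul_smul]

/-- As `ι_{∂_k}` is an antiderivation, `dx^l ∧ ι_{∂_k}` is a derivation. -/
theorem matrixDerivation_mul (A : Matrix (Fin n) (Fin n) ℝ) (a b : Forms n) :
    matrixDerivation A (a * b) = matrixDerivation A a * b + a * matrixDerivation A b := by
  induction a using CliffordAlgebra.left_induction with
  | algebraMap r =>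
    rw [← Algebra.smul_def, map_smul]
    erw [matrixDerivation_algebraMap]
    rw [zero_mul, zero_add, ← Algebra.smul_def]
  | add x y hx hy => rw [add_mul, map_add, hx, hy, map_add]; noncomm_ring
  | ι_mul x v hx =>
    have h := fun c => matrixDerivation_ι_mul A v c
    simp only [ExteriorAlgebra.ι] at h
    rw [mul_assoc, h, h, hx]
    noncomm_ring

/-- `[∑ A_kl dx^l ∧ ι_{∂_k}, ι_{∂_i}] = -∑ A_ki ι_{∂_k}`. -/
theorem matrixDerivation_contr (A : Matrix (Fin n) (Fin n) ℝ) (i : Fin n) (x : Forms n) :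
    matrixDerivation A (contr i x) = contr i (matrixDerivation A x) - ∑ k, A k i • contr k x := by
  simp only [matrixDerivation_apply, map_sum, map_smul, contr_dx_mul, smul_sub,
    Finset.sum_sub_distrib, smul_ite, smul_zero, Finset.sum_ite_eq, Finset.mem_univ, if_true]
  rw [sub_sub_cancel_left, ← Finset.sum_neg_distrib]
  refine Finset.sum_congr rfl fun k _ => ?_
  rw [← Finset.sum_neg_distrib]
  refine Finset.sum_congr rfl fun l _ => ?_
  rw [contr_comm k i, mul_neg, smul_neg]

/-- For a torsion-free connection the connection terms drop out of `∑_m dx^m ∧ ∇_{∂_m}`. -/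
theorem sum_dx_mul_matrixDerivation (Γ : Fin n → Matrix (Fin n) (Fin n) ℝ)
    (hΓ : ∀ m k l, Γ m k l = Γ l k m) (x : Forms n) :
    ∑ m, dx m * matrixDerivation (Γ m) x = 0 := by
  simp only [matrixDerivation_apply, Finset.mul_sum, mul_smul_comm, ← mul_assoc]
  rw [Finset.sum_comm]
  refine Finset.sum_eq_zero fun k _ => ?_
  -- exchanging `m` and `l` changes the sign of `dx^m ∧ dx^l` and preserves the coefficient
  refine eq_zero_of_eq_neg_real ?_
  rw [← Finset.sum_neg_distrib]
  conv_lhs => rw [Finset.sum_comm]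
  refine Finset.sum_congr rfl fun m _ => ?_
  rw [← Finset.sum_neg_distrib]
  refine Finset.sum_congr rfl fun l _ => ?_
  rw [dx_mul_dx_comm l m, hΓ l k m, neg_mul, smul_neg]

/-- The derivation of the algebra of double forms acting as `matrixDerivation A` on each of the
two factors. -/
def doubleDerivation (A : Matrix (Fin n) (Fin n) ℝ) : DoubleForm n →ₗ[ℝ] DoubleForm n :=
  LinearMap.rTensor (Forms n) (matrixDerivation A)
    + LinearMap.lTensor (Forms n) (matrixDerivation A)

theorem doubleDerivation_tmul (A : Matrix (Fin n) (Fin n) ℝ) (a b : Forms n) :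
    doubleDerivation A (a ⊗ₜ b) = matrixDerivation A a ⊗ₜ b + a ⊗ₜ matrixDerivation A b := by
  simp [doubleDerivation]

/-- Simultaneous induction on two double forms, reducing a biadditive claim to decomposable double
forms. -/
theorem doubleForm_induction₂ {p : DoubleForm n → DoubleForm n → Prop}
    (tmul : ∀ a b c d : Forms n, p (a ⊗ₜ b) (c ⊗ₜ d))
    (zero_left : ∀ β, p 0 β) (zero_right : ∀ α, p α 0)
    (add_left : ∀ α α' β, p α β → p α' β → p (α + α') β)
    (add_right : ∀ α β β', p α β → p α β' → p α (β + β')) (α β : DoubleForm n) : p α β := by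
  induction α using TensorProduct.induction_on with
  | zero => exact zero_left β
  | add x y hx hy => exact add_left x y β hx hy
  | tmul a b =>
    induction β using TensorProduct.induction_on with
    | zero => exact zero_right _
    | add x y hx hy => exact add_right _ x y hx hy
    | tmul c d => exact tmul a b c d

theorem doubleDerivation_mul (A : Matrix (Fin n) (Fin n) ℝ) (α β : DoubleForm n) :
    doubleDerivation A (α * β) = doubleDerivation A α * β + α * doubleDerivation A β := by
  refine doubleForm_induction₂ (p := fun α β => doubleDerivation A (α * β) =
    doubleDerivation A α * β + α * doubleDerivation A β) ?_ (by simp) (by simp) ?_ ?_ α β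
  · intro a b c d
    simp only [Algebra.TensorProduct.tmul_mul_tmul, doubleDerivation_tmul, matrixDerivation_mul,
      TensorProduct.tmul_add, TensorProduct.add_tmul, add_mul, mul_add]
    abel
  · intro α α' β h h'
    simp only [add_mul, map_add, h, h']; abel
  · intro α β β' h h'
    simp only [mul_add, map_add, h, h']; abel

theorem doubleDerivation_one (A : Matrix (Fin n) (Fin n) ℝ) :
    doubleDerivation A (1 : DoubleForm n) = 0 := by
  rw [Algebra.TensorProduct.one_def, doubleDerivation_tmul, matrixDerivation_one]
  simp

/-! ### The interior product of double forms -/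

theorem interiorForm_mul (G : Matrix (Fin n) (Fin n) ℝ) (a b x : Forms n) :
    interiorForm G (a * b) x = interiorForm G b (interiorForm G a x) := by
  simp only [interiorForm, LinearMap.comp_apply, AlgHom.toLinearMap_apply, map_mul]
  rfl

theorem interiorForm_one (G : Matrix (Fin n) (Fin n) ℝ) (x : Forms n) :
    interiorForm G 1 x = x := by
  simp only [interiorForm, LinearMap.comp_apply, AlgHom.toLinearMap_apply, map_one]
  rfl

/-- The covector `v` acts by contraction with the vector `v^♯ = G⁻¹ v`. -/
theorem interiorForm_ι (G : Matrix (Fin n) (Fin n) ℝ) (v : Fin n → ℝ) :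
    interiorForm G (ExteriorAlgebra.ι ℝ v) = ∑ i, Matrix.vecMul v G⁻¹ i • contr i := by
  ext1 x
  simp only [interiorForm, LinearMap.comp_apply, AlgHom.toLinearMap_apply,
    ExteriorAlgebra.lift_ι_apply, sharpContr]
  have : Matrix.toLinearMap₂' ℝ G⁻¹ v
      = ∑ i, Matrix.vecMul v G⁻¹ i • (LinearMap.proj i : (Fin n → ℝ) →ₗ[ℝ] ℝ) := by
    refine LinearMap.ext fun w => ?_
    rw [Matrix.toLinearMap₂'_apply', Matrix.dotProduct_mulVec]
    simp [dotProduct]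
  simp only [LinearEquiv.coe_coe, this, map_sum, map_smul]
  simp [contr]

theorem interiorForm_dx (G : Matrix (Fin n) (Fin n) ℝ) (j : Fin n) :
    interiorForm G (dx j) = ∑ i, G⁻¹ j i • contr i := by
  rw [dx, interiorForm_ι, Matrix.single_one_vecMul]
  rfl

theorem interior_tmul (G : Matrix (Fin n) (Fin n) ℝ) (a b : Forms n) :
    interior G (a ⊗ₜ b) = TensorProduct.map (interiorForm G a) (interiorForm G b) := by
  simp [interior]

theorem interior_mul (G : Matrix (Fin n) (Fin n) ℝ) (α β x : DoubleForm n) :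
    interior G (α * β) x = interior G β (interior G α x) := by
  revert x
  refine doubleForm_induction₂ (p := fun α β => ∀ x, interior G (α * β) x =
    interior G β (interior G α x)) ?_ (by simp) (by simp) ?_ ?_ α β
  · intro a b c d x
    rw [Algebra.TensorProduct.tmul_mul_tmul, interior_tmul, interior_tmul, interior_tmul]
    induction x using TensorProduct.induction_on with
    | zero => simp
    | add x y hx hy => simp only [map_add, hx, hy]
    | tmul x y => simp only [TensorProduct.map_tmul, interiorForm_mul]
  · intro α α' β h h' x
    simp only [add_mul, map_add, LinearMap.add_apply, h, h']
  · intro α β β' h h' x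
    simp only [mul_add, map_add, LinearMap.add_apply, h, h']

/-! ### Bidegrees -/

theorem contr_eq_zero_of_mem {a : Forms n} (ha : a ∈ ⋀[ℝ]^0 (Fin n → ℝ)) (k : Fin n) :
    contr k a = 0 := by
  rw [ExteriorAlgebra.exteriorPower, pow_zero, Submodule.mem_one] at ha
  obtain ⟨r, rfl⟩ := ha
  exact CliffordAlgebra.contractLeft_algebraMap _ _ _

/-- Induction on homogeneous forms of positive degree. -/
theorem exteriorPower_succ_induction {p : ℕ} {P : Forms n → Prop}
    (add : ∀ a b, P a → P b → P (a + b))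
    (ι_mul : ∀ v, ∀ b ∈ ⋀[ℝ]^p (Fin n → ℝ), P (ExteriorAlgebra.ι ℝ v * b))
    {a : Forms n} (ha : a ∈ ⋀[ℝ]^(p + 1) (Fin n → ℝ)) : P a := by
  rw [ExteriorAlgebra.exteriorPower, pow_succ'] at ha
  refine Submodule.mul_induction_on ha ?_ add
  rintro _ ⟨v, rfl⟩ b hb
  exact ι_mul v b hb

theorem ι_mul_mem_exteriorPower {p : ℕ} (v : Fin n → ℝ) {a : Forms n}
    (ha : a ∈ ⋀[ℝ]^p (Fin n → ℝ)) :
    ExteriorAlgebra.ι ℝ v * a ∈ ⋀[ℝ]^(p + 1) (Fin n → ℝ) := by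
  rw [ExteriorAlgebra.exteriorPower, pow_succ']
  exact Submodule.mul_mem_mul (LinearMap.mem_range_self _ v) ha

theorem contr_mem_exteriorPower {p : ℕ} {a : Forms n} (ha : a ∈ ⋀[ℝ]^(p + 1) (Fin n → ℝ))
    (k : Fin n) : contr k a ∈ ⋀[ℝ]^p (Fin n → ℝ) := by
  induction p generalizing a with
  | zero =>
    refine exteriorPower_succ_induction (P := fun a => contr k a ∈ ⋀[ℝ]^0 (Fin n → ℝ))
      (fun a b h h' => by rw [map_add]; exact add_mem h h') (fun v b hb => ?_) ha
    rw [contr_ι_mul, contr_eq_zero_of_mem hb, mul_zero, sub_zero]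
    exact Submodule.smul_mem _ _ hb
  | succ p ih =>
    refine exteriorPower_succ_induction (P := fun a => contr k a ∈ ⋀[ℝ]^(p + 1) (Fin n → ℝ))
      (fun a b h h' => by rw [map_add]; exact add_mem h h') (fun v b hb => ?_) ha
    rw [contr_ι_mul]
    exact sub_mem (Submodule.smul_mem _ _ hb) (ι_mul_mem_exteriorPower v (ih hb))

theorem matrixDerivation_mem_exteriorPower (A : Matrix (Fin n) (Fin n) ℝ) {p : ℕ} {a : Forms n}
    (ha : a ∈ ⋀[ℝ]^p (Fin n → ℝ)) : matrixDerivation A a ∈ ⋀[ℝ]^p (Fin n → ℝ) := by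
  rw [matrixDerivation_apply]
  refine sum_mem fun k _ => sum_mem fun l _ => Submodule.smul_mem _ _ ?_
  cases p with
  | zero => rw [contr_eq_zero_of_mem ha, mul_zero]; exact zero_mem _
  | succ p => exact ι_mul_mem_exteriorPower _ (contr_mem_exteriorPower ha k)

/-- The derivation belonging to the identity matrix is the degree operator. -/
theorem matrixDerivation_one_apply {p : ℕ} {a : Forms n} (ha : a ∈ ⋀[ℝ]^p (Fin n → ℝ)) :
    matrixDerivation 1 a = (p : ℝ) • a := by
  induction p generalizing a with
  | zero => simp [matrixDerivation_apply, contr_eq_zero_of_mem ha]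
  | succ p ih =>
    refine exteriorPower_succ_induction (P := fun a => matrixDerivation 1 a = ((p + 1 : ℕ) : ℝ) • a)
      (fun a b h h' => by rw [map_add, h, h', smul_add]) (fun v b hb => ?_) ha
    rw [matrixDerivation_mul, ih hb, matrixDerivation_ι, ι_eq_sum_dx]
    simp [Matrix.one_apply, add_smul, add_comm]

/-- The space of double forms of bidegree `(p, q)`. -/
def bidegree (n p q : ℕ) : Submodule ℝ (DoubleForm n) :=
  Submodule.map₂ (TensorProduct.mk ℝ (Forms n) (Forms n)) (⋀[ℝ]^p (Fin n → ℝ))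
    (⋀[ℝ]^q (Fin n → ℝ))

theorem tmul_mem_bidegree {p q : ℕ} {a b : Forms n} (ha : a ∈ ⋀[ℝ]^p (Fin n → ℝ))
    (hb : b ∈ ⋀[ℝ]^q (Fin n → ℝ)) : a ⊗ₜ[ℝ] b ∈ bidegree n p q :=
  Submodule.apply_mem_map₂ _ ha hb

theorem bidegree_map_mem {p q p' q' : ℕ} (L : DoubleForm n →ₗ[ℝ] DoubleForm n)
    (hL : ∀ a ∈ ⋀[ℝ]^p (Fin n → ℝ), ∀ b ∈ ⋀[ℝ]^q (Fin n → ℝ), L (a ⊗ₜ[ℝ] b) ∈ bidegree n p' q')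
    {x : DoubleForm n} (hx : x ∈ bidegree n p q) : L x ∈ bidegree n p' q' := by
  have : bidegree n p q ≤ (bidegree n p' q').comap L := Submodule.map₂_le.2 hL
  exact this hx

theorem bidegree_eqOn {V : Type*} [AddCommGroup V] [Module ℝ V] {p q : ℕ}
    {L L' : DoubleForm n →ₗ[ℝ] V}
    (hL : ∀ a ∈ ⋀[ℝ]^p (Fin n → ℝ), ∀ b ∈ ⋀[ℝ]^q (Fin n → ℝ), L (a ⊗ₜ[ℝ] b) = L' (a ⊗ₜ[ℝ] b))
    {x : DoubleForm n} (hx : x ∈ bidegree n p q) : L x = L' x := by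
  have : bidegree n p q ≤ LinearMap.eqLocus L L' := Submodule.map₂_le.2 hL
  exact this hx

theorem mul_mem_bidegree {p q p' q' : ℕ} {x y : DoubleForm n} (hx : x ∈ bidegree n p q)
    (hy : y ∈ bidegree n p' q') : x * y ∈ bidegree n (p + p') (q + q') := by
  have h1 : bidegree n p' q' ≤ (⨅ z ∈ bidegree n p q,
      (bidegree n (p + p') (q + q')).comap (LinearMap.mulLeft ℝ z)) := by
    refine Submodule.map₂_le.2 fun c hc d hd => ?_
    simp only [Submodule.mem_iInf, Submodule.mem_comap]
    intro z hz
    refine bidegree_map_mem (LinearMap.mulRight ℝ (c ⊗ₜ[ℝ] d)) (fun a ha b hb => ?_) hz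
    simp only [LinearMap.mulRight_apply, Algebra.TensorProduct.tmul_mul_tmul]
    refine tmul_mem_bidegree ?_ ?_
    · rw [ExteriorAlgebra.exteriorPower, pow_add]; exact Submodule.mul_mem_mul ha hc
    · rw [ExteriorAlgebra.exteriorPower, pow_add]; exact Submodule.mul_mem_mul hb hd
  have h2 := h1 hy
  simp only [Submodule.mem_iInf, Submodule.mem_comap] at h2
  exact h2 x hx

theorem pow_mem_bidegree {p q : ℕ} {x : DoubleForm n} (hx : x ∈ bidegree n p q) (k : ℕ) :
    x ^ k ∈ bidegree n (k * p) (k * q) := by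
  induction k with
  | zero =>
    simp only [pow_zero, zero_mul]
    exact tmul_mem_bidegree (by simp [Submodule.mem_one]) (by simp [Submodule.mem_one])
  | succ k ih => rw [pow_succ, add_mul, add_mul, one_mul, one_mul]; exact mul_mem_bidegree ih hx

theorem dx_mem_exteriorPower (i : Fin n) : dx i ∈ ⋀[ℝ]^1 (Fin n → ℝ) := by
  rw [ExteriorAlgebra.exteriorPower, pow_one]; exact LinearMap.mem_range_self _ _

theorem metricForm_mem_bidegree (G : Matrix (Fin n) (Fin n) ℝ) :
    metricForm G ∈ bidegree n 1 1 :=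
  sum_mem fun i _ => sum_mem fun j _ => Submodule.smul_mem _ _
    (tmul_mem_bidegree (dx_mem_exteriorPower i) (dx_mem_exteriorPower j))

theorem rTensor_contr_mem_bidegree {p q : ℕ} {x : DoubleForm n} (hx : x ∈ bidegree n (p + 1) q)
    (i : Fin n) : LinearMap.rTensor (Forms n) (contr i) x ∈ bidegree n p q :=
  bidegree_map_mem _ (fun _ ha _ hb => tmul_mem_bidegree (contr_mem_exteriorPower ha i) hb) hx

theorem lTensor_contr_mem_bidegree {p q : ℕ} {x : DoubleForm n} (hx : x ∈ bidegree n p (q + 1))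
    (i : Fin n) : LinearMap.lTensor (Forms n) (contr i) x ∈ bidegree n p q :=
  bidegree_map_mem _ (fun _ ha _ hb => tmul_mem_bidegree ha (contr_mem_exteriorPower hb i)) hx

theorem rTensor_contr_eq_zero {q : ℕ} {x : DoubleForm n} (hx : x ∈ bidegree n 0 q)
    (i : Fin n) : LinearMap.rTensor (Forms n) (contr i) x = 0 :=
  bidegree_eqOn (L' := 0) (fun a ha b _ => by simp [contr_eq_zero_of_mem ha]) hx

theorem lTensor_contr_eq_zero {p : ℕ} {x : DoubleForm n} (hx : x ∈ bidegree n p 0)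
    (i : Fin n) : LinearMap.lTensor (Forms n) (contr i) x = 0 :=
  bidegree_eqOn (L' := 0) (fun a _ b hb => by simp [contr_eq_zero_of_mem hb]) hx

theorem doubleDerivation_mem_bidegree (A : Matrix (Fin n) (Fin n) ℝ) {p q : ℕ} {x : DoubleForm n}
    (hx : x ∈ bidegree n p q) : doubleDerivation A x ∈ bidegree n p q :=
  bidegree_map_mem _ (fun a ha b hb => by
    rw [doubleDerivation_tmul]
    exact add_mem (tmul_mem_bidegree (matrixDerivation_mem_exteriorPower A ha) hb)
      (tmul_mem_bidegree ha (matrixDerivation_mem_exteriorPower A hb))) hx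

theorem doubleDerivation_one_apply {p q : ℕ} {x : DoubleForm n} (hx : x ∈ bidegree n p q) :
    doubleDerivation 1 x = ((p : ℝ) + q) • x :=
  bidegree_eqOn (L' := ((p : ℝ) + q) • LinearMap.id) (fun a ha b hb => by
    rw [doubleDerivation_tmul, matrixDerivation_one_apply ha, matrixDerivation_one_apply hb]
    simp [add_smul, TensorProduct.smul_tmul']) hx

/-! ### Multiplication by the metric is injective below the middle degree -/

/-- Contracting the first factor with `∂_i` sends `g` to the one-form `g(∂_i, ·)` of the second
factor. -/
theorem rTensor_contr_metricForm_mul (G : Matrix (Fin n) (Fin n) ℝ) (i : Fin n)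
    (x : DoubleForm n) : LinearMap.rTensor (Forms n) (contr i) (metricForm G * x)
      = ∑ l, G i l • (((1 : Forms n) ⊗ₜ[ℝ] dx l) * x)
        - metricForm G * LinearMap.rTensor (Forms n) (contr i) x := by
  induction x using TensorProduct.induction_on with
  | zero => simp
  | add x y hx hy =>
    simp only [mul_add, map_add, hx, hy, smul_add, Finset.sum_add_distrib]; abel
  | tmul a b =>
    simp only [metricForm, Finset.sum_mul, map_sum, smul_mul_assoc, map_smul,
      Algebra.TensorProduct.tmul_mul_tmul, LinearMap.rTensor_tmul, contr_dx_mul,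
      TensorProduct.sub_tmul, smul_sub, Finset.sum_sub_distrib, one_mul]
    congr 1
    rw [Finset.sum_eq_single i (fun k _ hk => by simp [hk.symm]) (by simp)]
    simp

theorem lTensor_contr_metricForm_mul (G : Matrix (Fin n) (Fin n) ℝ) (j : Fin n)
    (x : DoubleForm n) : LinearMap.lTensor (Forms n) (contr j) (metricForm G * x)
      = ∑ k, G k j • ((dx k ⊗ₜ[ℝ] (1 : Forms n)) * x)
        - metricForm G * LinearMap.lTensor (Forms n) (contr j) x := by
  induction x using TensorProduct.induction_on with
  | zero => simp
  | add x y hx hy =>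
    simp only [mul_add, map_add, hx, hy, smul_add, Finset.sum_add_distrib]; abel
  | tmul a b =>
    simp only [metricForm, Finset.sum_mul, map_sum, smul_mul_assoc, map_smul,
      Algebra.TensorProduct.tmul_mul_tmul, LinearMap.lTensor_tmul, contr_dx_mul,
      TensorProduct.tmul_sub, smul_sub, Finset.sum_sub_distrib, one_mul]
    congr 1
    refine Finset.sum_congr rfl fun k _ => ?_
    rw [Finset.sum_eq_single j (fun k _ hk => by simp [hk.symm]) (by simp)]
    simp

theorem lTensor_contr_dx_mul (j l : Fin n) (x : DoubleForm n) :
    LinearMap.lTensor (Forms n) (contr j) (((1 : Forms n) ⊗ₜ[ℝ] dx l) * x)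
      = (if j = l then x else 0)
        - ((1 : Forms n) ⊗ₜ[ℝ] dx l) * LinearMap.lTensor (Forms n) (contr j) x := by
  induction x using TensorProduct.induction_on with
  | zero => simp
  | add x y hx hy =>
    simp only [mul_add, map_add, hx, hy]; split_ifs <;> abel
  | tmul a b =>
    simp only [Algebra.TensorProduct.tmul_mul_tmul, LinearMap.lTensor_tmul, contr_dx_mul,
      TensorProduct.tmul_sub, one_mul]
    split_ifs <;> simp

theorem doubleDerivation_one_eq (x : DoubleForm n) : doubleDerivation 1 x =
    ∑ k, (dx k ⊗ₜ[ℝ] (1 : Forms n)) * LinearMap.rTensor (Forms n) (contr k) x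
      + ∑ k, ((1 : Forms n) ⊗ₜ[ℝ] dx k) * LinearMap.lTensor (Forms n) (contr k) x := by
  induction x using TensorProduct.induction_on with
  | zero => simp
  | add x y hx hy =>
    simp only [mul_add, map_add, hx, hy, Finset.sum_add_distrib]; abel
  | tmul a b =>
    simp [doubleDerivation_tmul, matrixDerivation_apply, Matrix.one_apply,
      TensorProduct.sum_tmul, TensorProduct.tmul_sum]

/-- The contraction `∑ g^{ij} ι_{∂_i} ⊗ ι_{∂_j}` of double forms, the adjoint of the
multiplication by the metric. -/
def metricContraction (G : Matrix (Fin n) (Fin n) ℝ) : DoubleForm n →ₗ[ℝ] DoubleForm n :=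
  ∑ i, ∑ j, G⁻¹ i j •
    (LinearMap.lTensor (Forms n) (contr j) ∘ₗ LinearMap.rTensor (Forms n) (contr i))

theorem metricContraction_apply (G : Matrix (Fin n) (Fin n) ℝ) (x : DoubleForm n) :
    metricContraction G x = ∑ i, ∑ j, G⁻¹ i j •
      LinearMap.lTensor (Forms n) (contr j) (LinearMap.rTensor (Forms n) (contr i) x) := by
  simp only [metricContraction, LinearMap.sum_apply, LinearMap.smul_apply, LinearMap.comp_apply]

/-- The contraction and the multiplication by the metric generate a copy of `sl₂`, with the
degree operator as third generator. -/
theorem metricContraction_metricForm_mul {G : Matrix (Fin n) (Fin n) ℝ} (hG : G.IsSymm)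
    (hdet : IsUnit G.det) (x : DoubleForm n) :
    metricContraction G (metricForm G * x)
      = metricForm G * metricContraction G x + ((n : ℝ) • x - doubleDerivation 1 x) := by
  have hinv : G⁻¹ * G = 1 := Matrix.nonsing_inv_mul G hdet
  have hinv' : G * G⁻¹ = 1 := Matrix.mul_nonsing_inv G hdet
  have hsymm : ∀ i j, G i j = G j i := fun i j => hG.apply j i
  have e1 : ∀ i j, ∑ k, G⁻¹ i k * G k j = (1 : Matrix (Fin n) (Fin n) ℝ) i j := fun i j => by
    rw [← hinv, Matrix.mul_apply]
  have e2 : ∀ i j, ∑ k, G i k * G⁻¹ k j = (1 : Matrix (Fin n) (Fin n) ℝ) i j := fun i j => by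
    rw [← hinv', Matrix.mul_apply]
  set r := fun i => LinearMap.rTensor (Forms n) (contr i) x
  set l := fun i => LinearMap.lTensor (Forms n) (contr i) x
  have key : ∀ i j, LinearMap.lTensor (Forms n) (contr j)
      (LinearMap.rTensor (Forms n) (contr i) (metricForm G * x)) =
      G i j • x - ∑ a, G i a • (((1 : Forms n) ⊗ₜ[ℝ] dx a) * l j)
      - ∑ a, G a j • ((dx a ⊗ₜ[ℝ] (1 : Forms n)) * r i)
      + metricForm G * LinearMap.lTensor (Forms n) (contr j) (r i) := by
    intro i j
    rw [rTensor_contr_metricForm_mul, map_sub, lTensor_contr_metricForm_mul]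
    simp only [map_sum, map_smul, lTensor_contr_dx_mul, smul_sub, Finset.sum_sub_distrib,
      smul_ite, smul_zero, Finset.sum_ite_eq, Finset.mem_univ, if_true]
    abel
  simp only [metricContraction_apply, key, smul_add, smul_sub, Finset.sum_add_distrib,
    Finset.sum_sub_distrib, Finset.smul_sum, smul_smul]
  have t1 : ∑ i, ∑ j, (G⁻¹ i j * G i j) • x = (n : ℝ) • x := by
    simp only [← Finset.sum_smul]
    congr 1
    calc ∑ i, ∑ j, G⁻¹ i j * G i j = ∑ i, ∑ j, G⁻¹ i j * G j i := by
          simp only [hsymm _ _]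
      _ = n := by simp [e1]
  have t2 : ∑ i, ∑ j, ∑ a, (G⁻¹ i j * G i a) • (((1 : Forms n) ⊗ₜ[ℝ] dx a) * l j)
      = ∑ k, ((1 : Forms n) ⊗ₜ[ℝ] dx k) * l k := by
    rw [Finset.sum_comm]
    refine Finset.sum_congr rfl fun j _ => ?_
    rw [Finset.sum_comm]
    simp only [← Finset.sum_smul]
    have : ∀ a, ∑ i, G⁻¹ i j * G i a = (1 : Matrix (Fin n) (Fin n) ℝ) a j := fun a => by
      rw [← e2]
      exact Finset.sum_congr rfl fun i _ => by rw [hsymm i a, mul_comm]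
    simp [this, Matrix.one_apply]
  have t3 : ∑ i, ∑ j, ∑ a, (G⁻¹ i j * G a j) • ((dx a ⊗ₜ[ℝ] (1 : Forms n)) * r i)
      = ∑ k, (dx k ⊗ₜ[ℝ] (1 : Forms n)) * r k := by
    refine Finset.sum_congr rfl fun i _ => ?_
    rw [Finset.sum_comm]
    simp only [← Finset.sum_smul]
    have : ∀ a, ∑ j, G⁻¹ i j * G a j = (1 : Matrix (Fin n) (Fin n) ℝ) i a := fun a => by
      rw [← e1]
      exact Finset.sum_congr rfl fun j _ => by rw [hsymm a j]
    simp [this, Matrix.one_apply]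
  rw [t1, t2, t3, doubleDerivation_one_eq]
  simp only [Finset.mul_sum, mul_smul_comm]
  abel

/-- The commutator of the contraction with `g^{m+1}` on bidegree `(p, q)`: each factor `g` passed
contributes the value of `n -` (total degree) at that stage. -/
theorem metricContraction_metricForm_pow_mul {G : Matrix (Fin n) (Fin n) ℝ} (hG : G.IsSymm)
    (hdet : IsUnit G.det) {p q : ℕ} {x : DoubleForm n} (hx : x ∈ bidegree n p q) (m : ℕ) :
    metricContraction G (metricForm G ^ (m + 1) * x)
      = metricForm G ^ (m + 1) * metricContraction G x
        + (((m : ℝ) + 1) * (n - p - q - m)) • (metricForm G ^ m * x) := by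
  induction m with
  | zero =>
    rw [zero_add, pow_one, metricContraction_metricForm_mul hG hdet,
      doubleDerivation_one_apply hx, ← sub_smul]
    simp only [Nat.cast_zero, zero_add, one_mul, pow_zero, sub_zero, sub_sub]
  | succ m ih =>
    have hm : metricForm G ^ (m + 1) * x ∈ bidegree n (m + 1 + p) (m + 1 + q) := by
      simpa using mul_mem_bidegree (pow_mem_bidegree (metricForm_mem_bidegree G) (m + 1)) hx
    rw [pow_succ' _ (m + 1), mul_assoc, metricContraction_metricForm_mul hG hdet,
      doubleDerivation_one_apply hm, ih, mul_add, mul_smul_comm, ← mul_assoc, ← mul_assoc,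
      ← pow_succ', ← pow_succ', ← sub_smul, add_assoc, ← add_smul]
    congr 2
    push_cast
    ring

/-- The primitive case `c x = 0`: the coefficient in `c (g^{m+1} x) = (m+1)(n-p-q-m) g^m x` does
not vanish in the given range, so that powers of `g` can be cancelled one at a time. -/
theorem eq_zero_of_metricContraction_eq_zero {G : Matrix (Fin n) (Fin n) ℝ} (hG : G.IsSymm)
    (hdet : IsUnit G.det) {p q m : ℕ} (hpq : p + q + m ≤ n) {x : DoubleForm n}
    (hx : x ∈ bidegree n p q) (h : metricForm G ^ m * x = 0) (hc : metricContraction G x = 0) :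
    x = 0 := by
  induction m with
  | zero => simpa using h
  | succ m ih =>
    refine ih (by omega) ?_
    have h2 := metricContraction_metricForm_pow_mul hG hdet hx m
    rw [h, hc, map_zero, mul_zero, zero_add, eq_comm, smul_eq_zero] at h2
    refine h2.resolve_left (mul_ne_zero (by positivity) ?_)
    have : ((p + q + (m + 1) : ℕ) : ℝ) ≤ n := by exact_mod_cast hpq
    push_cast at this ⊢
    linarith

/-- Multiplication by `g^m` is injective on double forms of bidegree `(p, q)` if
`p + q + m ≤ n`. -/
theorem eq_zero_of_metricForm_pow_mul_eq_zero {G : Matrix (Fin n) (Fin n) ℝ} (hG : G.IsSymm)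
    (hdet : IsUnit G.det) {p q m : ℕ} (hpq : p + q + m ≤ n) {x : DoubleForm n}
    (hx : x ∈ bidegree n p q) (h : metricForm G ^ m * x = 0) : x = 0 := by
  -- the contraction of `x` satisfies the same hypotheses with `p - 1`, `q - 1` and `m + 1`
  induction p generalizing q m x with
  | zero =>
    have hc : metricContraction G x = 0 := by
      simp [metricContraction_apply, rTensor_contr_eq_zero hx]
    exact eq_zero_of_metricContraction_eq_zero hG hdet hpq hx h hc
  | succ p ihp =>
    have hc : metricContraction G x = 0 := by
      cases q with
      | zero =>
        rw [metricContraction_apply]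
        refine Finset.sum_eq_zero fun i _ => Finset.sum_eq_zero fun j _ => ?_
        rw [lTensor_contr_eq_zero (rTensor_contr_mem_bidegree hx i), smul_zero]
      | succ q =>
        refine ihp (q := q) (m := m + 1) (by omega) ?_ ?_
        · rw [metricContraction_apply]
          exact sum_mem fun i _ => sum_mem fun j _ => Submodule.smul_mem _ _
            (lTensor_contr_mem_bidegree (rTensor_contr_mem_bidegree hx i) j)
        · have h2 := metricContraction_metricForm_pow_mul hG hdet hx m
          rw [pow_succ', mul_assoc, h, mul_zero, map_zero, smul_zero, add_zero,
            ← pow_succ'] at h2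
          exact h2.symm
    exact eq_zero_of_metricContraction_eq_zero hG hdet hpq hx h hc

/-! ### Partial derivatives of smooth functions -/

section Smooth

variable {U : Set (EuclideanSpace ℝ (Fin n))} {y : EuclideanSpace ℝ (Fin n)}

theorem contDiffOn_pderiv (hU : IsOpen U) {f : EuclideanSpace ℝ (Fin n) → ℝ}
    (hf : ContDiffOn ℝ ∞ f U) (i : Fin n) : ContDiffOn ℝ ∞ (pderiv i f) U :=
  (hf.fderiv_of_isOpen hU (m := ∞) (by simp)).clm_apply contDiffOn_const

theorem differentiableAt_of_contDiffOn (hU : IsOpen U) {f : EuclideanSpace ℝ (Fin n) → ℝ}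
    (hf : ContDiffOn ℝ ∞ f U) (hy : y ∈ U) : DifferentiableAt ℝ f y :=
  (hf.contDiffAt (hU.mem_nhds hy)).differentiableAt (by simp)

theorem pderiv_comm (hU : IsOpen U) {f : EuclideanSpace ℝ (Fin n) → ℝ}
    (hf : ContDiffOn ℝ ∞ f U) (hy : y ∈ U) (i j : Fin n) :
    pderiv i (pderiv j f) y = pderiv j (pderiv i f) y := by
  have hd : DifferentiableAt ℝ (fderiv ℝ f) y :=
    ((hf.fderiv_of_isOpen hU (m := ∞) (by simp)).contDiffAt (hU.mem_nhds hy)).differentiableAt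
      (by simp)
  have h : ∀ a b, pderiv a (pderiv b f) y
      = fderiv ℝ (fderiv ℝ f) y (EuclideanSpace.single a 1) (EuclideanSpace.single b 1) := by
    intro a b
    have : pderiv b f = fun z => fderiv ℝ f z (EuclideanSpace.single b 1) := rfl
    rw [this, pderiv, fderiv_clm_apply hd (differentiableAt_const _)]
    simp
  rw [h, h]
  exact (hf.contDiffAt (hU.mem_nhds hy)).isSymmSndFDerivAt
    (by simpa using WithTop.coe_le_coe.2 (le_top : (2 : ℕ∞) ≤ ⊤)) _ _

/-- The matrix-valued function `A` has smooth entries on `U`. -/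
def SmoothMatrixOn (A : EuclideanSpace ℝ (Fin n) → Matrix (Fin n) (Fin n) ℝ)
    (U : Set (EuclideanSpace ℝ (Fin n))) : Prop :=
  ∀ a b, ContDiffOn ℝ ∞ (fun z => A z a b) U

/-- The entrywise partial derivative of a matrix-valued function. -/
def pderivMatrix (i : Fin n) (A : EuclideanSpace ℝ (Fin n) → Matrix (Fin n) (Fin n) ℝ)
    (y : EuclideanSpace ℝ (Fin n)) : Matrix (Fin n) (Fin n) ℝ :=
  Matrix.of fun a b => pderiv i (fun z => A z a b) y

namespace SmoothMatrixOn

variable {A B : EuclideanSpace ℝ (Fin n) → Matrix (Fin n) (Fin n) ℝ}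

theorem hasPartial (hA : SmoothMatrixOn A U) (hU : IsOpen U) (hy : y ∈ U) (i : Fin n) :
    HasPartial i A (pderivMatrix i A y) y :=
  hasPartial_matrix fun a b => differentiableAt_of_contDiffOn hU (hA a b) hy

theorem pderivMatrix (hA : SmoothMatrixOn A U) (hU : IsOpen U) (i : Fin n) :
    SmoothMatrixOn (pderivMatrix i A) U :=
  fun a b => contDiffOn_pderiv hU (hA a b) i

theorem pderivMatrix_comm (hA : SmoothMatrixOn A U) (hU : IsOpen U) (hy : y ∈ U) (i j : Fin n) :
    ThorpeGeometry.pderivMatrix i (ThorpeGeometry.pderivMatrix j A) y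
      = ThorpeGeometry.pderivMatrix j (ThorpeGeometry.pderivMatrix i A) y := by
  ext a b
  exact pderiv_comm hU (hA a b) hy i j

theorem det (hA : SmoothMatrixOn A U) : ContDiffOn ℝ ∞ (fun z => (A z).det) U := by
  simp only [Matrix.det_apply]
  refine ContDiffOn.sum fun σ _ => ?_
  exact (contDiffOn_prod fun i _ => hA (σ i) i).const_smul _

/-- The entries of the inverse are smooth by Cramer's rule. -/
theorem inv (hA : SmoothMatrixOn A U) (hdet : ∀ z ∈ U, IsUnit (A z).det) :
    SmoothMatrixOn (fun z => (A z)⁻¹) U := by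
  intro a b
  have hadj : ContDiffOn ℝ ∞ (fun z => (A z).adjugate a b) U := by
    simp only [Matrix.adjugate_apply]
    refine SmoothMatrixOn.det (A := fun z => (A z).updateRow b (Pi.single a 1)) fun c d => ?_
    by_cases hc : c = b
    · subst hc; simpa using contDiffOn_const
    · simpa [Matrix.updateRow_ne hc] using hA c d
  have : ContDiffOn ℝ ∞ (fun z => ((A z).det)⁻¹ * (A z).adjugate a b) U :=
    (hA.det.inv fun z hz => (hdet z hz).ne_zero).mul hadj
  refine this.congr fun z _ => ?_
  simp [Matrix.inv_def]

end SmoothMatrixOn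

end Smooth

/-! ### The Levi-Civita connection and the curvature in a chart -/

/-- `G` is the matrix of a smooth nondegenerate symmetric metric on the open set `U`. -/
structure IsLocalMetric (G : EuclideanSpace ℝ (Fin n) → Matrix (Fin n) (Fin n) ℝ)
    (U : Set (EuclideanSpace ℝ (Fin n))) : Prop where
  isOpen : IsOpen U
  smooth : SmoothMatrixOn G U
  isSymm : ∀ z ∈ U, (G z).IsSymm
  isUnit_det : ∀ z ∈ U, IsUnit (G z).det

/-- The connection matrix `(Γ^k_il)_{k,l}` of the derivative in the direction `∂_i`. -/
def connectionMatrix (G : EuclideanSpace ℝ (Fin n) → Matrix (Fin n) (Fin n) ℝ) (i : Fin n)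
    (y : EuclideanSpace ℝ (Fin n)) : Matrix (Fin n) (Fin n) ℝ :=
  Matrix.of fun k l => christoffel G k i l y

/-- The matrix `(R^l_{kij})_{l,k}` of the curvature operator `R(∂_i, ∂_j)`. -/
def curvatureMatrix (G : EuclideanSpace ℝ (Fin n) → Matrix (Fin n) (Fin n) ℝ) (i j : Fin n)
    (y : EuclideanSpace ℝ (Fin n)) : Matrix (Fin n) (Fin n) ℝ :=
  Matrix.of fun l k => curvatureUp G l k i j y

theorem curvatureMatrix_eq (G : EuclideanSpace ℝ (Fin n) → Matrix (Fin n) (Fin n) ℝ) (i j : Fin n)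
    (y : EuclideanSpace ℝ (Fin n)) : curvatureMatrix G i j y =
      pderivMatrix i (connectionMatrix G j) y - pderivMatrix j (connectionMatrix G i) y
        + (connectionMatrix G i y * connectionMatrix G j y
          - connectionMatrix G j y * connectionMatrix G i y) := by
  ext l k
  simp [curvatureMatrix, curvatureUp, pderivMatrix, connectionMatrix, Matrix.mul_apply,
    Finset.sum_sub_distrib]

theorem curvatureDown_eq (G : EuclideanSpace ℝ (Fin n) → Matrix (Fin n) (Fin n) ℝ)
    (i j k l : Fin n) (y : EuclideanSpace ℝ (Fin n)) :
    curvatureDown G i j k l y = (G y * curvatureMatrix G i j y) k l := by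
  simp [curvatureDown, curvatureMatrix, Matrix.mul_apply]

namespace IsLocalMetric

variable {G : EuclideanSpace ℝ (Fin n) → Matrix (Fin n) (Fin n) ℝ}
  {U : Set (EuclideanSpace ℝ (Fin n))} {y : EuclideanSpace ℝ (Fin n)}

theorem pderiv_symm (hG : IsLocalMetric G U) (hy : y ∈ U) (i a b : Fin n) :
    pderiv i (fun z => G z a b) y = pderiv i (fun z => G z b a) y := by
  have : (fun z => G z a b) =ᶠ[nhds y] fun z => G z b a := by
    filter_upwards [hG.isOpen.mem_nhds hy] with z hz
    exact (hG.isSymm z hz).apply b a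
  rw [pderiv, this.fderiv_eq, pderiv]

theorem smooth_connectionMatrix (hG : IsLocalMetric G U) (i : Fin n) :
    SmoothMatrixOn (connectionMatrix G i) U := by
  intro a b
  simp only [connectionMatrix, Matrix.of_apply, christoffel]
  refine contDiffOn_const.mul (ContDiffOn.sum fun l _ => ?_)
  refine (hG.smooth.inv hG.isUnit_det a l).mul ?_
  exact ((contDiffOn_pderiv hG.isOpen (hG.smooth _ _) _).add
    (contDiffOn_pderiv hG.isOpen (hG.smooth _ _) _)).sub
    (contDiffOn_pderiv hG.isOpen (hG.smooth _ _) _)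

/-- The Levi-Civita connection is torsion-free. -/
theorem connectionMatrix_symm (hG : IsLocalMetric G U) (hy : y ∈ U) (i k l : Fin n) :
    connectionMatrix G i y k l = connectionMatrix G l y k i := by
  simp only [connectionMatrix, Matrix.of_apply, christoffel]
  congr 1
  refine Finset.sum_congr rfl fun s _ => ?_
  rw [hG.pderiv_symm hy s i l]
  ring

/-- Lowering the index of `Γ` gives the Christoffel symbols of the first kind. -/
theorem mul_connectionMatrix (hG : IsLocalMetric G U) (hy : y ∈ U) (i l j : Fin n) :
    (G y * connectionMatrix G i y) l j = (1 / 2 : ℝ) * (pderiv i (fun z => G z j l) y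
      + pderiv j (fun z => G z i l) y - pderiv l (fun z => G z i j) y) := by
  set X : Fin n → ℝ := fun l => pderiv i (fun z => G z j l) y
    + pderiv j (fun z => G z i l) y - pderiv l (fun z => G z i j) y
  have h1 : (fun k => connectionMatrix G i y k j) = (1 / 2 : ℝ) • ((G y)⁻¹.mulVec X) := by
    ext k
    simp [connectionMatrix, christoffel, Matrix.mulVec, dotProduct, X]
  have h2 : (G y * connectionMatrix G i y) l j
      = (G y).mulVec (fun k => connectionMatrix G i y k j) l := by
    simp [Matrix.mul_apply, Matrix.mulVec, dotProduct]
  rw [h2, h1, Matrix.mulVec_smul, Matrix.mulVec_mulVec,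
    Matrix.mul_nonsing_inv _ (hG.isUnit_det y hy), Matrix.one_mulVec]
  simp [X]

/-- The Levi-Civita connection is compatible with the metric. -/
theorem pderivMatrix_eq (hG : IsLocalMetric G U) (hy : y ∈ U) (i : Fin n) :
    pderivMatrix i G y
      = (connectionMatrix G i y).transpose * G y + G y * connectionMatrix G i y := by
  have : (connectionMatrix G i y).transpose * G y
      = (G y * connectionMatrix G i y).transpose := by
    rw [Matrix.transpose_mul, (hG.isSymm y hy).eq]
  rw [this]
  ext a b
  rw [Matrix.add_apply, Matrix.transpose_apply, hG.mul_connectionMatrix hy,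
    hG.mul_connectionMatrix hy, pderivMatrix, Matrix.of_apply, hG.pderiv_symm hy i b a]
  ring

theorem hasPartial (hG : IsLocalMetric G U) (hy : y ∈ U) (i : Fin n) :
    HasPartial i G ((connectionMatrix G i y).transpose * G y + G y * connectionMatrix G i y) y := by
  rw [← hG.pderivMatrix_eq hy]
  exact hG.smooth.hasPartial hG.isOpen hy i

theorem hasPartial_inv (hG : IsLocalMetric G U) (hy : y ∈ U) (i : Fin n) :
    HasPartial i (fun z => (G z)⁻¹)
      (-((G y)⁻¹ * (connectionMatrix G i y).transpose + connectionMatrix G i y * (G y)⁻¹)) y := by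
  have hinv := (hG.smooth.inv hG.isUnit_det).hasPartial hG.isOpen hy i
  set X := pderivMatrix i (fun z => (G z)⁻¹) y
  -- differentiate `G⁻¹ G = 1`
  have h1 := (hinv.mul (hG.hasPartial hy i)).unique
    ((HasPartial.const (1 : Matrix (Fin n) (Fin n) ℝ)).congr_of_eventuallyEq (by
      filter_upwards [hG.isOpen.mem_nhds hy] with z hz
      exact Matrix.nonsing_inv_mul _ (hG.isUnit_det z hz)))
  have hr := Matrix.mul_nonsing_inv _ (hG.isUnit_det y hy)
  have hl := Matrix.nonsing_inv_mul _ (hG.isUnit_det y hy)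
  have h2 : X = -((G y)⁻¹ * (connectionMatrix G i y).transpose
      + connectionMatrix G i y * (G y)⁻¹) := by
    have h3 := congrArg (· * (G y)⁻¹) h1
    simp only [zero_mul, add_mul, mul_add, mul_assoc, hr, mul_one] at h3
    rw [← mul_assoc (G y)⁻¹ (G y), hl, one_mul] at h3
    exact eq_neg_of_add_eq_zero_left h3
  rwa [← h2]

theorem curvatureMatrix_swap (G : EuclideanSpace ℝ (Fin n) → Matrix (Fin n) (Fin n) ℝ)
    (i j : Fin n) (y : EuclideanSpace ℝ (Fin n)) :
    curvatureMatrix G j i y = -curvatureMatrix G i j y := by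
  rw [curvatureMatrix_eq, curvatureMatrix_eq]; abel

/-- The curvature operators are skew-adjoint with respect to the metric. -/
theorem mul_curvatureMatrix_transpose (hG : IsLocalMetric G U) (hy : y ∈ U) (i j : Fin n) :
    (G y * curvatureMatrix G i j y).transpose = -(G y * curvatureMatrix G i j y) := by
  have h1 : ∀ i j, pderivMatrix i (pderivMatrix j G) y
      = (pderivMatrix i (connectionMatrix G j) y).transpose * G y
        + (connectionMatrix G j y).transpose * ((connectionMatrix G i y).transpose * G y
          + G y * connectionMatrix G i y)
        + (((connectionMatrix G i y).transpose * G y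
          + G y * connectionMatrix G i y) * connectionMatrix G j y
          + G y * pderivMatrix i (connectionMatrix G j) y) := by
    intro i j
    have hA := (hG.smooth_connectionMatrix j).hasPartial hG.isOpen hy i
    have hAt := hA.comp_linear
      (Matrix.transposeLinearEquiv (Fin n) (Fin n) ℝ ℝ).toLinearMap
    refine ((hG.smooth.pderivMatrix hG.isOpen j).hasPartial hG.isOpen hy i).unique ?_
    refine HasPartial.congr_of_eventuallyEq
      ((hAt.mul (hG.hasPartial hy i)).add ((hG.hasPartial hy i).mul hA)) ?_
    filter_upwards [hG.isOpen.mem_nhds hy] with z hz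
    exact hG.pderivMatrix_eq hz j
  -- the skew part of the second derivatives of `G` is `Fᵀ G + G F` with `F` the curvature matrix
  have h2 := hG.smooth.pderivMatrix_comm hG.isOpen hy i j
  rw [h1, h1] at h2
  rw [curvatureMatrix_eq, Matrix.transpose_mul, (hG.isSymm y hy).eq, Matrix.transpose_add,
    Matrix.transpose_sub, Matrix.transpose_sub, Matrix.transpose_mul, Matrix.transpose_mul,
    eq_neg_iff_add_eq_zero, ← sub_eq_zero.2 h2]
  noncomm_ring

/-- The first Bianchi identity. -/
theorem curvatureMatrix_cyclic (hG : IsLocalMetric G U) (hy : y ∈ U) (i j k l : Fin n) :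
    curvatureMatrix G i j y l k + curvatureMatrix G j k y l i + curvatureMatrix G k i y l j
      = 0 := by
  have hd : ∀ a b c, pderivMatrix a (connectionMatrix G b) y l c
      = pderivMatrix a (connectionMatrix G c) y l b := by
    intro a b c
    have : (fun z => connectionMatrix G b z l c)
        =ᶠ[nhds y] fun z => connectionMatrix G c z l b := by
      filter_upwards [hG.isOpen.mem_nhds hy] with z hz
      exact hG.connectionMatrix_symm hz b l c
    rw [pderivMatrix, Matrix.of_apply, pderiv, this.fderiv_eq]
    rfl
  have hm : ∀ a b c, (connectionMatrix G a y * connectionMatrix G b y) l c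
      = (connectionMatrix G a y * connectionMatrix G c y) l b := by
    intro a b c
    simp only [Matrix.mul_apply]
    exact Finset.sum_congr rfl fun m _ => by rw [hG.connectionMatrix_symm hy b m c]
  simp only [curvatureMatrix_eq, Matrix.add_apply, Matrix.sub_apply]
  rw [hd i j k, hd j k i, hd k i j, hm i j k, hm j k i, hm k i j]
  ring

/-- `R_ijkl = R_klij` follows from the antisymmetry in each pair and four instances of the first
Bianchi identity. -/
theorem curvatureDown_pair_symm (hG : IsLocalMetric G U) (hy : y ∈ U) (i j k l : Fin n) :
    curvatureDown G i j k l y = curvatureDown G k l i j y := by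
  have h1 : ∀ i j k l, curvatureDown G j i k l y = -curvatureDown G i j k l y := by
    intro i j k l
    rw [curvatureDown_eq, curvatureDown_eq, curvatureMatrix_swap G i j, mul_neg, Matrix.neg_apply]
  have h2 : ∀ i j k l, curvatureDown G i j l k y = -curvatureDown G i j k l y := by
    intro i j k l
    rw [curvatureDown_eq, curvatureDown_eq, ← Matrix.neg_apply,
      ← hG.mul_curvatureMatrix_transpose hy, Matrix.transpose_apply]
  have h3 : ∀ i j k l, curvatureDown G i j k l y + curvatureDown G j l k i y
      + curvatureDown G l i k j y = 0 := by
    intro i j k l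
    simp only [curvatureDown_eq, Matrix.mul_apply, ← Finset.sum_add_distrib, ← mul_add]
    exact Finset.sum_eq_zero fun m _ => by rw [hG.curvatureMatrix_cyclic hy i j l m, mul_zero]
  have a1 := h3 i j k l
  have a2 := h3 j k l i
  have a3 := h3 k l i j
  have a4 := h3 l i j k
  linarith [h1 i j k l, h2 i j k l, h1 j l k i, h2 j l k i, h1 l i k j, h2 l i k j,
    h1 j k l i, h2 j k l i, h1 k i l j, h2 k i l j, h1 i j l k, h2 i j l k,
    h1 k l i j, h2 k l i j, h1 l j i k, h2 l j i k, h1 j k i l, h2 j k i l,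
    h1 l i j k, h2 l i j k, h1 i k j l, h2 i k j l, h1 k l j i, h2 k l j i,
    h1 i k l j, h1 j l i k, h1 l j k i, h1 k i j l]

/-- The second Bianchi identity for the curvature operators: the cyclic sum of
`∂_m F_ij + [A_m, F_ij]` vanishes. -/
theorem pderivMatrix_curvatureMatrix_cyclic (hG : IsLocalMetric G U) (hy : y ∈ U) :
    ∃ F' : Fin n → Fin n → Fin n → Matrix (Fin n) (Fin n) ℝ,
      (∀ m i j, HasPartial m (curvatureMatrix G i j) (F' m i j) y) ∧
      ∀ m i j, let Q := fun m i j => F' m i j + connectionMatrix G m y * curvatureMatrix G i j y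
          - curvatureMatrix G i j y * connectionMatrix G m y
        Q m i j + Q i j m + Q j m i = 0 := by
  let A := connectionMatrix G
  have hA : ∀ i m, HasPartial m (A i) (pderivMatrix m (A i) y) y := fun i m =>
    (hG.smooth_connectionMatrix i).hasPartial hG.isOpen hy m
  have hdA : ∀ i j m, HasPartial m (pderivMatrix j (A i))
      (pderivMatrix m (pderivMatrix j (A i)) y) y := fun i j m =>
    ((hG.smooth_connectionMatrix i).pderivMatrix hG.isOpen j).hasPartial hG.isOpen hy m
  have hcomm : ∀ i j m, pderivMatrix m (pderivMatrix j (A i)) y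
      = pderivMatrix j (pderivMatrix m (A i)) y := fun i j m =>
    (hG.smooth_connectionMatrix i).pderivMatrix_comm hG.isOpen hy m j
  refine ⟨fun m i j => pderivMatrix m (pderivMatrix i (A j)) y
    - pderivMatrix m (pderivMatrix j (A i)) y
    + ((pderivMatrix m (A i) y * A j y + A i y * pderivMatrix m (A j) y)
      - (pderivMatrix m (A j) y * A i y + A j y * pderivMatrix m (A i) y)), ?_, ?_⟩
  · intro m i j
    rw [funext (curvatureMatrix_eq G i j)]
    exact ((hdA j i m).sub (hdA i j m)).add (((hA i m).mul (hA j m)).sub ((hA j m).mul (hA i m)))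
  · intro m i j
    simp only [curvatureMatrix_eq]
    rw [hcomm j i m, hcomm m j i, hcomm i j m]
    simp only [A]
    -- what remains is the Jacobi identity
    noncomm_ring

end IsLocalMetric

section CovariantDerivative

variable {G : EuclideanSpace ℝ (Fin n) → Matrix (Fin n) (Fin n) ℝ}
  {U : Set (EuclideanSpace ℝ (Fin n))} {y : EuclideanSpace ℝ (Fin n)} {j : Fin n}

/-! ### Covariant derivatives of fields of double forms -/

/-- The field `α` of double forms is differentiable in the direction `∂_j` at `y`, with covariant
derivative `∇_{∂_j} α = β`. -/
def HasCovDeriv (G : EuclideanSpace ℝ (Fin n) → Matrix (Fin n) (Fin n) ℝ) (j : Fin n)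
    (α : EuclideanSpace ℝ (Fin n) → DoubleForm n) (β : DoubleForm n)
    (y : EuclideanSpace ℝ (Fin n)) : Prop :=
  HasPartial j α (β + doubleDerivation (connectionMatrix G j y) (α y)) y

namespace HasCovDeriv

variable {α α' : EuclideanSpace ℝ (Fin n) → DoubleForm n} {β β' : DoubleForm n}

theorem covDeriv_eq (h : HasCovDeriv G j α β y) : covDeriv G j α y = β := by
  have h2 : doubleDerivation (connectionMatrix G j y) (α y)
      = LinearMap.rTensor (Forms n) (connectionForms G j y) (α y)
        + LinearMap.lTensor (Forms n) (connectionForms G j y) (α y) := rfl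
  rw [covDeriv, HasPartial.partialForm_eq h, ← h2, add_sub_cancel_right]

theorem unique (h : HasCovDeriv G j α β y) (h' : HasCovDeriv G j α β' y) : β = β' :=
  add_right_cancel (HasPartial.unique h h')

theorem mul (h : HasCovDeriv G j α β y) (h' : HasCovDeriv G j α' β' y) :
    HasCovDeriv G j (fun z => α z * α' z) (β * α' y + α y * β') y := by
  have := HasPartial.mul h h'
  refine HasPartial.of_eq this ?_
  rw [doubleDerivation_mul]
  noncomm_ring

theorem const_smul (h : HasCovDeriv G j α β y) (c : ℝ) :
    HasCovDeriv G j (fun z => c • α z) (c • β) y := by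
  have := HasPartial.comp_linear h (c • LinearMap.id)
  refine HasPartial.of_eq this ?_
  simp

theorem one : HasCovDeriv G j (fun _ => 1) 0 y := by
  unfold HasCovDeriv
  rw [doubleDerivation_one, add_zero]
  exact HasPartial.const _

theorem congr_of_eventuallyEq (h : HasCovDeriv G j α β y) (hα : α' =ᶠ[nhds y] α) :
    HasCovDeriv G j α' β y := by
  unfold HasCovDeriv
  rw [hα.self_of_nhds]
  exact HasPartial.congr_of_eventuallyEq h hα

end HasCovDeriv

/-- The metric is parallel. -/
theorem IsLocalMetric.hasCovDeriv_metricForm (hG : IsLocalMetric G U) (hy : y ∈ U) (j : Fin n) :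
    HasCovDeriv G j (fun z => metricForm (G z)) 0 y := by
  let L : Matrix (Fin n) (Fin n) ℝ →ₗ[ℝ] DoubleForm n :=
    ∑ a, ∑ b, (LinearMap.toSpanSingleton ℝ _ (dx a ⊗ₜ[ℝ] dx b)) ∘ₗ Matrix.entryLinearMap ℝ ℝ a b
  have hL : ∀ P, L P = metricForm P := fun P => by simp [L, metricForm]
  have h := (hG.hasPartial hy j).comp_linear L
  simp only [hL] at h
  refine HasPartial.of_eq h ?_
  simp only [metricForm, zero_add, map_sum, map_smul, doubleDerivation_tmul, matrixDerivation_dx,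
    TensorProduct.sum_tmul, TensorProduct.tmul_sum, TensorProduct.smul_tmul',
    TensorProduct.tmul_smul, Finset.sum_add_distrib, Matrix.add_apply, add_smul,
    Matrix.mul_apply, Matrix.transpose_apply, Finset.sum_smul, Finset.smul_sum, smul_smul]
  congr 1
  · rw [Finset.sum_comm]
    conv_rhs => rw [Finset.sum_comm]
    refine Finset.sum_congr rfl fun b _ => ?_
    rw [Finset.sum_comm]
    exact Finset.sum_congr rfl fun a _ => Finset.sum_congr rfl fun c _ => by rw [mul_comm]
  · refine Finset.sum_congr rfl fun a _ => ?_
    rw [Finset.sum_comm]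
    exact Finset.sum_congr rfl fun b _ => Finset.sum_congr rfl fun c _ => by rw [mul_comm]

theorem IsLocalMetric.hasCovDeriv_metricForm_pow_mul (hG : IsLocalMetric G U) (hy : y ∈ U)
    {α : EuclideanSpace ℝ (Fin n) → DoubleForm n} {β : DoubleForm n}
    (h : HasCovDeriv G j α β y) (m : ℕ) :
    HasCovDeriv G j (fun z => metricForm (G z) ^ m * α z) (metricForm (G y) ^ m * β) y := by
  induction m with
  | zero => simpa using h
  | succ m ih =>
    have := (hG.hasCovDeriv_metricForm hy j).mul ih
    simpa only [pow_succ', mul_assoc, zero_mul, zero_add] using this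

/-! ### The Hodge star operator is parallel -/

/-- The Leibniz rule for the evaluation of a field of linear maps whose derivative is known only
pointwise. -/
theorem HasPartial.linearMap_apply {V W : Type*} [AddCommGroup V] [Module ℝ V] [AddCommGroup W]
    [Module ℝ W] [Module.Finite ℝ V] {T : EuclideanSpace ℝ (Fin n) → V →ₗ[ℝ] W}
    {T' : V →ₗ[ℝ] W} {v : EuclideanSpace ℝ (Fin n) → V} {v' : V}
    (hT : ∀ x, HasPartial j (fun z => T z x) (T' x) y) (hv : HasPartial j v v' y) :
    HasPartial j (fun z => T z (v z)) (T' (v y) + T y v') y := by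
  let b := Module.finBasis ℝ V
  have hB : ∀ (S : V →ₗ[ℝ] W) u, S u = ∑ i, b.repr u i • S (b i) := fun S u => by
    conv_lhs => rw [← b.sum_repr u]
    simp only [map_sum, map_smul]
  rw [hB T' (v y), hB (T y) v', funext fun z => hB (T z) (v z), add_comm,
    ← Finset.sum_add_distrib]
  exact HasPartial.sum _ fun i _ => (hv.comp_linear (b.coord i)).smul (hT (b i))

/-- The interior product of forms is parallel: `∇ (ι_a x) = ι_{∇ a} x + ι_a (∇ x)`. -/
theorem IsLocalMetric.hasPartial_interiorForm (hG : IsLocalMetric G U) (hy : y ∈ U) (j : Fin n)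
    (a : Forms n) : HasPartial j (fun z => interiorForm (G z) a)
      (matrixDerivation (connectionMatrix G j y) ∘ₗ interiorForm (G y) a
        - interiorForm (G y) a ∘ₗ matrixDerivation (connectionMatrix G j y)
        - interiorForm (G y) (matrixDerivation (connectionMatrix G j y) a)) y := by
  set A := connectionMatrix G j y
  have hι : ∀ v : Fin n → ℝ, HasPartial j (fun z => interiorForm (G z) (ExteriorAlgebra.ι ℝ v))
      (matrixDerivation A ∘ₗ interiorForm (G y) (ExteriorAlgebra.ι ℝ v)
        - interiorForm (G y) (ExteriorAlgebra.ι ℝ v) ∘ₗ matrixDerivation A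
        - interiorForm (G y) (matrixDerivation A (ExteriorAlgebra.ι ℝ v))) y := by
    intro v
    let L : Matrix (Fin n) (Fin n) ℝ →ₗ[ℝ] (Forms n →ₗ[ℝ] Forms n) :=
      ∑ i, ∑ k, v k • (LinearMap.toSpanSingleton ℝ _ (contr i)) ∘ₗ Matrix.entryLinearMap ℝ ℝ k i
    have hL : ∀ P, L P = ∑ i, Matrix.vecMul v P i • contr i := fun P => by
      simp [L, Matrix.vecMul, dotProduct, Finset.sum_smul, smul_smul]
    have h := (hG.hasPartial_inv hy j).comp_linear L
    simp only [hL, ← interiorForm_ι] at h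
    refine HasPartial.of_eq h ?_
    have h1 : matrixDerivation A (ExteriorAlgebra.ι ℝ v)
        = ExteriorAlgebra.ι ℝ (Matrix.vecMul v A) := by
      rw [matrixDerivation_ι, ι_eq_sum_dx, Finset.sum_comm]
      simp [Matrix.vecMul, dotProduct, Finset.sum_smul, mul_comm]
    have h2 : matrixDerivation A ∘ₗ interiorForm (G y) (ExteriorAlgebra.ι ℝ v)
        - interiorForm (G y) (ExteriorAlgebra.ι ℝ v) ∘ₗ matrixDerivation A
        = -∑ k, Matrix.vecMul v ((G y)⁻¹ * A.transpose) k • contr k := by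
      rw [interiorForm_ι]
      refine LinearMap.ext fun x => ?_
      simp only [LinearMap.sub_apply, LinearMap.comp_apply, LinearMap.sum_apply,
        LinearMap.smul_apply, map_sum, map_smul, LinearMap.neg_apply, matrixDerivation_contr,
        smul_sub, Finset.sum_sub_distrib, sub_sub_cancel_left, ← Matrix.vecMul_vecMul]
      congr 1
      simp only [Finset.smul_sum, smul_smul]
      rw [Finset.sum_comm]
      refine Finset.sum_congr rfl fun k _ => ?_
      rw [← Finset.sum_smul]
      rfl
    rw [h2, h1, interiorForm_ι, Matrix.vecMul_vecMul]
    simp only [Matrix.vecMul_neg, Matrix.vecMul_add, Pi.neg_apply, Pi.add_apply, neg_smul,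
      add_smul, Finset.sum_neg_distrib, Finset.sum_add_distrib, neg_add]
    abel
  induction a using CliffordAlgebra.left_induction with
  | algebraMap r =>
    have h0 : ∀ P : Matrix (Fin n) (Fin n) ℝ,
        interiorForm P (algebraMap ℝ (Forms n) r) = r • LinearMap.id := fun P => by
      refine LinearMap.ext fun x => ?_
      rw [Algebra.algebraMap_eq_smul_one, map_smul, LinearMap.smul_apply, interiorForm_one]
      rfl
    have h1 := HasPartial.const (j := j) (y := y) (r • (LinearMap.id : Forms n →ₗ[ℝ] Forms n))
    erw [matrixDerivation_algebraMap, h0]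
    simp only [map_zero, LinearMap.comp_smul, LinearMap.smul_comp, LinearMap.comp_id,
      LinearMap.id_comp, sub_self]
    exact h1.congr_of_eventuallyEq (Filter.Eventually.of_forall fun z => h0 (G z))
  | add x x' hx hx' =>
    have := hx.add hx'
    simp only [map_add]
    refine HasPartial.of_eq this ?_
    refine LinearMap.ext fun w => ?_
    simp only [LinearMap.sub_apply, LinearMap.add_apply, LinearMap.comp_apply, map_add]
    abel
  | ι_mul x v hx =>
    have h0 : ∀ P : Matrix (Fin n) (Fin n) ℝ, interiorForm P (ExteriorAlgebra.ι ℝ v * x)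
        = interiorForm P x ∘ₗ interiorForm P (ExteriorAlgebra.ι ℝ v) := fun P => by
      exact LinearMap.ext fun w => interiorForm_mul P _ _ w
    have := (HasPartial.bilin (LinearMap.mul ℝ (Module.End ℝ (Forms n))) hx
      (hι v)).congr_of_eventuallyEq
      (Filter.Eventually.of_forall fun z => h0 (G z))
    refine HasPartial.of_eq this ?_
    refine LinearMap.ext fun w => ?_
    change _ = (((matrixDerivation A ∘ₗ interiorForm (G y) x
      - interiorForm (G y) x ∘ₗ matrixDerivation A
      - interiorForm (G y) (matrixDerivation A x)) ∘ₗ interiorForm (G y) (ExteriorAlgebra.ι ℝ v)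
      + interiorForm (G y) x ∘ₗ (matrixDerivation A ∘ₗ interiorForm (G y) (ExteriorAlgebra.ι ℝ v)
        - interiorForm (G y) (ExteriorAlgebra.ι ℝ v) ∘ₗ matrixDerivation A
        - interiorForm (G y) (matrixDerivation A (ExteriorAlgebra.ι ℝ v)))) w)
    have h3 := matrixDerivation_mul A (ExteriorAlgebra.ι ℝ v) x
    have h4 := h0 (G y)
    simp only [ExteriorAlgebra.ι] at h3 h4 ⊢
    rw [h3, h4]
    simp only [LinearMap.sub_apply, LinearMap.add_apply, LinearMap.comp_apply, map_add, map_sub,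
      interiorForm_mul]
    abel

/-- The interior product of double forms is parallel. -/
theorem IsLocalMetric.hasPartial_interior (hG : IsLocalMetric G U) (hy : y ∈ U) (j : Fin n)
    (α : DoubleForm n) : HasPartial j (fun z => interior (G z) α)
      (doubleDerivation (connectionMatrix G j y) ∘ₗ interior (G y) α
        - interior (G y) α ∘ₗ doubleDerivation (connectionMatrix G j y)
        - interior (G y) (doubleDerivation (connectionMatrix G j y) α)) y := by
  induction α using TensorProduct.induction_on with
  | zero => simpa using HasPartial.const 0
  | add x x' hx hx' =>
    have := hx.add hx'
    simp only [map_add]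
    refine HasPartial.of_eq this ?_
    refine LinearMap.ext fun w => ?_
    simp only [LinearMap.sub_apply, LinearMap.add_apply, LinearMap.comp_apply, map_add]
    abel
  | tmul a b =>
    have h := (hG.hasPartial_interiorForm hy j a).bilin
      (TensorProduct.mapBilinear (.id ℝ) (Forms n) (Forms n) (Forms n) (Forms n))
      (hG.hasPartial_interiorForm hy j b)
    have h1 : (fun z => interior (G z) (a ⊗ₜ[ℝ] b))
        = fun z => TensorProduct.map (interiorForm (G z) a) (interiorForm (G z) b) :=
      funext fun z => interior_tmul (G z) a b
    rw [h1]
    refine HasPartial.of_eq h ?_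
    refine TensorProduct.ext' fun c d => ?_
    simp only [doubleDerivation_tmul, map_add, interior_tmul, LinearMap.sub_apply,
      LinearMap.add_apply, LinearMap.comp_apply, TensorProduct.map_tmul,
      TensorProduct.mapBilinear_apply, TensorProduct.sub_tmul, TensorProduct.tmul_sub]
    abel

/-- `∇ (⋆α) = ⋆(∇α)`. -/
theorem IsLocalMetric.hasCovDeriv_hodgeStar (hG : IsLocalMetric G U) (hy : y ∈ U)
    {α : EuclideanSpace ℝ (Fin n) → DoubleForm n} {β : DoubleForm n}
    (h : HasCovDeriv G j α β y) :
    HasCovDeriv G j (fun z => hodgeStar (G z) (α z)) (hodgeStar (G y) β) y := by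
  set K := doubleDerivation (connectionMatrix G j y)
  have hvol : HasCovDeriv G j (fun z => (n.factorial : ℝ)⁻¹ • metricForm (G z) ^ n) 0 y := by
    simpa using (hG.hasCovDeriv_metricForm_pow_mul hy HasCovDeriv.one n).const_smul
      (n.factorial : ℝ)⁻¹
  let T' : DoubleForm n →ₗ[ℝ] Module.End ℝ (DoubleForm n) :=
    LinearMap.mulLeft ℝ K ∘ₗ interior (G y) - LinearMap.mulRight ℝ K ∘ₗ interior (G y)
      - interior (G y) ∘ₗ K
  have h1 := HasPartial.linearMap_apply (T := fun z => interior (G z)) (T' := T')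
    (hG.hasPartial_interior hy j) h
  have h2 := HasPartial.bilin (LinearMap.id : Module.End ℝ (DoubleForm n) →ₗ[ℝ] _) h1 hvol
  refine HasPartial.of_eq h2 ?_
  simp only [T', hodgeStar, LinearMap.id_apply, LinearMap.add_apply, LinearMap.sub_apply,
    LinearMap.comp_apply, LinearMap.mulLeft_apply, LinearMap.mulRight_apply, Module.End.mul_apply,
    map_add, zero_add, K]
  abel

/-! ### The second Bianchi identity for the curvature double form -/

/-- The two-form `∑ P_kl dx^k ∧ dx^l` (without a factor `1/2`) of a matrix `P`. -/
def twoForm : Matrix (Fin n) (Fin n) ℝ →ₗ[ℝ] Forms n :=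
  ∑ k, ∑ l, (LinearMap.toSpanSingleton ℝ _ (dx k * dx l)) ∘ₗ Matrix.entryLinearMap ℝ ℝ k l

theorem twoForm_apply (P : Matrix (Fin n) (Fin n) ℝ) :
    twoForm P = ∑ k, ∑ l, P k l • (dx k * dx l) := by
  simp [twoForm]

theorem matrixDerivation_twoForm (A P : Matrix (Fin n) (Fin n) ℝ) :
    matrixDerivation A (twoForm P) = twoForm (A.transpose * P + P * A) := by
  simp only [twoForm_apply, map_sum, map_smul, matrixDerivation_mul, matrixDerivation_dx,
    smul_add, Finset.sum_add_distrib, Matrix.add_apply, add_smul, Matrix.mul_apply,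
    Matrix.transpose_apply, Finset.sum_smul, Finset.smul_sum, smul_smul, Finset.sum_mul,
    Finset.mul_sum, smul_mul_assoc, mul_smul_comm]
  congr 1
  · rw [Finset.sum_comm]
    conv_rhs => rw [Finset.sum_comm]
    refine Finset.sum_congr rfl fun b _ => ?_
    rw [Finset.sum_comm]
    exact Finset.sum_congr rfl fun a _ => Finset.sum_congr rfl fun c _ => by rw [mul_comm]
  · refine Finset.sum_congr rfl fun a _ => ?_
    rw [Finset.sum_comm]

theorem curvatureForm_eq (G : EuclideanSpace ℝ (Fin n) → Matrix (Fin n) (Fin n) ℝ)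
    (y : EuclideanSpace ℝ (Fin n)) : curvatureForm G y = (1 / 4 : ℝ) • ∑ i, ∑ j,
      (dx i * dx j) ⊗ₜ[ℝ] twoForm (G y * curvatureMatrix G i j y) := by
  simp only [curvatureForm, twoForm_apply, curvatureDown_eq, TensorProduct.tmul_sum,
    TensorProduct.tmul_smul]

theorem dx_mul_dx_mem_exteriorPower (i j : Fin n) : dx i * dx j ∈ ⋀[ℝ]^2 (Fin n → ℝ) :=
  ι_mul_mem_exteriorPower _ (dx_mem_exteriorPower j)

theorem curvatureForm_mem_bidegree (G : EuclideanSpace ℝ (Fin n) → Matrix (Fin n) (Fin n) ℝ)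
    (y : EuclideanSpace ℝ (Fin n)) : curvatureForm G y ∈ bidegree n 2 2 :=
  Submodule.smul_mem _ _ <| sum_mem fun i _ => sum_mem fun j _ => sum_mem fun k _ =>
    sum_mem fun l _ => Submodule.smul_mem _ _ <|
      tmul_mem_bidegree (dx_mul_dx_mem_exteriorPower i j) (dx_mul_dx_mem_exteriorPower k l)

theorem dx_mul_dx_commute (m i j : Fin n) : Commute (dx m) (dx i * dx j) := by
  rw [commute_iff_eq, ← mul_assoc, dx_mul_dx_comm m i, neg_mul, mul_assoc, dx_mul_dx_comm m j,
    mul_neg, neg_neg, mul_assoc]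

theorem commute_curvatureForm_left (G : EuclideanSpace ℝ (Fin n) → Matrix (Fin n) (Fin n) ℝ)
    (y : EuclideanSpace ℝ (Fin n)) (m : Fin n) :
    Commute (dx m ⊗ₜ[ℝ] (1 : Forms n)) (curvatureForm G y) := by
  refine Commute.smul_right (Commute.sum_right _ _ _ fun i _ => Commute.sum_right _ _ _ fun j _ =>
    Commute.sum_right _ _ _ fun k _ => Commute.sum_right _ _ _ fun l _ =>
      Commute.smul_right ?_ _) _
  rw [commute_iff_eq, Algebra.TensorProduct.tmul_mul_tmul, Algebra.TensorProduct.tmul_mul_tmul,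
    (dx_mul_dx_commute m i j).eq, one_mul, mul_one]

theorem commute_curvatureForm_right (G : EuclideanSpace ℝ (Fin n) → Matrix (Fin n) (Fin n) ℝ)
    (y : EuclideanSpace ℝ (Fin n)) (m : Fin n) :
    Commute ((1 : Forms n) ⊗ₜ[ℝ] dx m) (curvatureForm G y) := by
  refine Commute.smul_right (Commute.sum_right _ _ _ fun i _ => Commute.sum_right _ _ _ fun j _ =>
    Commute.sum_right _ _ _ fun k _ => Commute.sum_right _ _ _ fun l _ =>
      Commute.smul_right ?_ _) _
  rw [commute_iff_eq, Algebra.TensorProduct.tmul_mul_tmul, Algebra.TensorProduct.tmul_mul_tmul,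
    (dx_mul_dx_commute m k l).eq, one_mul, mul_one]

/-- A sum against the totally antisymmetric `dx^m ∧ dx^i ∧ dx^j` vanishes if the cyclic sums of
the coefficients do. -/
theorem sum_dx_tmul_eq_zero_of_cyclic {w : Fin n → Fin n → Fin n → Forms n}
    (hw : ∀ m i j, w m i j + w i j m + w j m i = 0) :
    ∑ m, ∑ i, ∑ j, (dx m * (dx i * dx j)) ⊗ₜ[ℝ] w m i j = 0 := by
  set S := ∑ m, ∑ i, ∑ j, (dx m * (dx i * dx j)) ⊗ₜ[ℝ] w m i j with hS
  have ht : ∀ m i j : Fin n, dx m * (dx i * dx j) = dx i * (dx j * dx m) := fun m i j => by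
    rw [(dx_mul_dx_commute m i j).eq, mul_assoc]
  have h1 : ∑ m, ∑ i, ∑ j, (dx m * (dx i * dx j)) ⊗ₜ[ℝ] w i j m = S := by
    rw [Finset.sum_comm, hS]
    refine Finset.sum_congr rfl fun i _ => ?_
    rw [Finset.sum_comm]
    exact Finset.sum_congr rfl fun j _ => Finset.sum_congr rfl fun m _ => by rw [ht m i j]
  have h2 : ∑ m, ∑ i, ∑ j, (dx m * (dx i * dx j)) ⊗ₜ[ℝ] w j m i = S := by
    rw [hS]
    conv_rhs => rw [Finset.sum_comm]
    refine Finset.sum_congr rfl fun m _ => ?_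
    conv_rhs => rw [Finset.sum_comm]
    exact Finset.sum_congr rfl fun i _ => Finset.sum_congr rfl fun j _ => by rw [ht j m i]
  have h3 : (3 : ℝ) • S = 0 := by
    calc (3 : ℝ) • S = S + S + S := by rw [← one_smul ℝ S, smul_smul]; module
      _ = ∑ m, ∑ i, ∑ j, (dx m * (dx i * dx j)) ⊗ₜ[ℝ] (w m i j + w i j m + w j m i) := by
        simp only [TensorProduct.tmul_add, Finset.sum_add_distrib]
        rw [h1, h2]
      _ = 0 := by simp [hw]
  simpa using h3

theorem sum_dx_mul_rTensor (Γ : Fin n → Matrix (Fin n) (Fin n) ℝ)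
    (hΓ : ∀ m k l, Γ m k l = Γ l k m) (x : DoubleForm n) :
    ∑ m, (dx m ⊗ₜ[ℝ] (1 : Forms n)) * LinearMap.rTensor (Forms n) (matrixDerivation (Γ m)) x
      = 0 := by
  induction x using TensorProduct.induction_on with
  | zero => simp
  | add x x' hx hx' => simp only [map_add, mul_add, Finset.sum_add_distrib, hx, hx', add_zero]
  | tmul a b =>
    simp only [LinearMap.rTensor_tmul, Algebra.TensorProduct.tmul_mul_tmul, one_mul,
      ← TensorProduct.sum_tmul, sum_dx_mul_matrixDerivation Γ hΓ, TensorProduct.zero_tmul]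

/-- The exchange of the two factors of a double form. -/
abbrev swapForm : DoubleForm n ≃ₐ[ℝ] DoubleForm n :=
  Algebra.TensorProduct.comm ℝ (Forms n) (Forms n)

theorem swapForm_doubleDerivation (A : Matrix (Fin n) (Fin n) ℝ) (x : DoubleForm n) :
    swapForm (doubleDerivation A x) = doubleDerivation A (swapForm x) := by
  induction x using TensorProduct.induction_on with
  | zero => simp
  | add x x' hx hx' => simp only [map_add, hx, hx']
  | tmul a b => simp [doubleDerivation_tmul, add_comm]

theorem IsLocalMetric.swapForm_curvatureForm (hG : IsLocalMetric G U) (hy : y ∈ U) :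
    swapForm (curvatureForm G y) = curvatureForm G y := by
  have hs : ∀ a b : Forms n, swapForm.toLinearMap (a ⊗ₜ[ℝ] b) = b ⊗ₜ[ℝ] a := fun _ _ => rfl
  change swapForm.toLinearMap (curvatureForm G y) = _
  simp only [curvatureForm, map_smul, map_sum, hs]
  refine congrArg _ ?_
  let f : Fin n × Fin n → Fin n × Fin n → DoubleForm n := fun p q =>
    curvatureDown G p.1 p.2 q.1 q.2 y • ((dx q.1 * dx q.2) ⊗ₜ[ℝ] (dx p.1 * dx p.2))
  have h1 : ∑ p, ∑ q, f p q = ∑ q, ∑ p, f p q := Finset.sum_comm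
  simp only [Fintype.sum_prod_type, f] at h1
  rw [h1]
  refine Finset.sum_congr rfl fun i _ => Finset.sum_congr rfl fun j _ =>
    Finset.sum_congr rfl fun k _ => Finset.sum_congr rfl fun l _ => ?_
  rw [hG.curvatureDown_pair_symm hy]

/-- The field `α` of double forms is differentiable at `y` with covariant derivatives
`∇_{∂_j} α = β_j`, and is closed at `y` with respect to either of its two factors. -/
structure HasClosedCovDeriv (G : EuclideanSpace ℝ (Fin n) → Matrix (Fin n) (Fin n) ℝ)
    (α : EuclideanSpace ℝ (Fin n) → DoubleForm n) (β : Fin n → DoubleForm n)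
    (y : EuclideanSpace ℝ (Fin n)) : Prop where
  hasCovDeriv : ∀ j, HasCovDeriv G j α (β j) y
  closed_left : ∑ j, (dx j ⊗ₜ[ℝ] (1 : Forms n)) * β j = 0
  closed_right : ∑ j, ((1 : Forms n) ⊗ₜ[ℝ] dx j) * β j = 0

/-- The second Bianchi identity. -/
theorem IsLocalMetric.exists_hasClosedCovDeriv_curvatureForm (hG : IsLocalMetric G U)
    (hy : y ∈ U) : ∃ β, HasClosedCovDeriv G (curvatureForm G) β y := by
  obtain ⟨F', hF', hcyc⟩ := hG.pderivMatrix_curvatureMatrix_cyclic hy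
  set A := fun m => connectionMatrix G m y
  set F := fun i j => curvatureMatrix G i j y
  let P' := fun m i j => ((A m).transpose * G y + G y * A m) * F i j + G y * F' m i j
  let R' := fun m => (1 / 4 : ℝ) • ∑ i, ∑ j, (dx i * dx j) ⊗ₜ[ℝ] twoForm (P' m i j)
  have hR' : ∀ m, HasPartial m (curvatureForm G) (R' m) y := by
    intro m
    let L : Fin n → Fin n → Matrix (Fin n) (Fin n) ℝ →ₗ[ℝ] DoubleForm n := fun i j =>
      (TensorProduct.mk ℝ (Forms n) (Forms n) (dx i * dx j)) ∘ₗ twoForm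
    rw [funext (curvatureForm_eq G)]
    have h1 := (HasPartial.sum Finset.univ fun i _ => HasPartial.sum Finset.univ fun j _ =>
      ((hG.hasPartial hy m).mul (hF' m i j)).comp_linear (L i j)).comp_linear
        ((1 / 4 : ℝ) • LinearMap.id)
    simp only [LinearMap.smul_apply, LinearMap.id_apply] at h1
    exact h1
  let β := fun m => R' m - doubleDerivation (A m) (curvatureForm G y)
  have hβ : ∀ m, HasCovDeriv G m (curvatureForm G) (β m) y := fun m =>
    (hR' m).of_eq (sub_add_cancel _ _)
  obtain ⟨Q, hQ⟩ : ∃ Q : Fin n → Fin n → Fin n → Matrix (Fin n) (Fin n) ℝ,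
      ∀ m i j, Q m i j = F' m i j + A m * F i j - F i j * A m := ⟨_, fun _ _ _ => rfl⟩
  have hleft : ∑ m, (dx m ⊗ₜ[ℝ] (1 : Forms n)) * β m = 0 := by
    have h1 : ∀ m, β m = (1 / 4 : ℝ) • ∑ i, ∑ j, (dx i * dx j) ⊗ₜ[ℝ]
        twoForm (G y * Q m i j)
        - LinearMap.rTensor (Forms n) (matrixDerivation (A m)) (curvatureForm G y) := by
      intro m
      have h2 : LinearMap.lTensor (Forms n) (matrixDerivation (A m)) (curvatureForm G y)
          = (1 / 4 : ℝ) • ∑ i, ∑ j, (dx i * dx j) ⊗ₜ[ℝ]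
            twoForm ((A m).transpose * (G y * F i j) + G y * F i j * A m) := by
        simp only [curvatureForm_eq, map_smul, map_sum, LinearMap.lTensor_tmul,
          matrixDerivation_twoForm, F]
      have h3 : ∀ i j, G y * Q m i j
          = P' m i j - ((A m).transpose * (G y * F i j) + G y * F i j * A m) := fun i j => by
        simp only [P', hQ]; noncomm_ring
      simp only [β, R', doubleDerivation, LinearMap.add_apply, h2, h3, map_sub,
        TensorProduct.tmul_sub, Finset.sum_sub_distrib, smul_sub]
      abel
    simp only [h1, mul_sub, Finset.sum_sub_distrib]
    rw [sum_dx_mul_rTensor A fun m k l => hG.connectionMatrix_symm hy m k l, sub_zero]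
    simp only [mul_smul_comm, Finset.mul_sum, Algebra.TensorProduct.tmul_mul_tmul, one_mul,
      ← Finset.smul_sum]
    rw [sum_dx_tmul_eq_zero_of_cyclic, smul_zero]
    intro m i j
    have h4 : Q m i j + Q i j m + Q j m i = 0 := by
      rw [hQ, hQ, hQ]
      exact hcyc m i j
    rw [← map_add, ← map_add, ← mul_add, ← mul_add, h4, mul_zero, map_zero]
  -- closedness in the second factor follows by exchanging the factors
  have hswap : ∀ m, swapForm (β m) = β m := by
    intro m
    have h1 : swapForm (R' m) = R' m := by
      refine ((hR' m).comp_linear swapForm.toLinearMap).unique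
        ((hR' m).congr_of_eventuallyEq ?_)
      filter_upwards [hG.isOpen.mem_nhds hy] with z hz
      exact hG.swapForm_curvatureForm hz
    simp only [β, map_sub, swapForm_doubleDerivation, h1, hG.swapForm_curvatureForm hy]
  refine ⟨β, hβ, hleft, ?_⟩
  have := congrArg swapForm hleft
  simpa only [map_sum, map_mul, Algebra.TensorProduct.comm_tmul, hswap, map_zero] using this

/-- The powers of the curvature form are closed in both factors, as `R` commutes with the one-forms
of either factor. -/
theorem HasClosedCovDeriv.exists_pow_curvatureForm {β : Fin n → DoubleForm n}
    (h : HasClosedCovDeriv G (curvatureForm G) β y) (k : ℕ) :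
    ∃ γ, HasClosedCovDeriv G (fun z => curvatureForm G z ^ k) γ y := by
  induction k with
  | zero =>
    refine ⟨0, fun j => ?_, by simp, by simp⟩
    simpa using HasCovDeriv.one
  | succ k ih =>
    obtain ⟨γ, hγ⟩ := ih
    refine ⟨fun j => β j * curvatureForm G y ^ k + curvatureForm G y * γ j, fun j => ?_, ?_, ?_⟩
    · simpa only [pow_succ'] using (h.hasCovDeriv j).mul (hγ.hasCovDeriv j)
    · simp only [mul_add, Finset.sum_add_distrib, ← mul_assoc,
        (commute_curvatureForm_left G y _).eq]
      simp only [mul_assoc, ← Finset.mul_sum, hγ.closed_left]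
      simp only [← mul_assoc, ← Finset.sum_mul, h.closed_left, zero_mul, mul_zero, add_zero]
    · simp only [mul_add, Finset.sum_add_distrib, ← mul_assoc,
        (commute_curvatureForm_right G y _).eq]
      simp only [mul_assoc, ← Finset.mul_sum, hγ.closed_right]
      simp only [← mul_assoc, ← Finset.sum_mul, h.closed_right, zero_mul, mul_zero, add_zero]

/-! ### The divergence -/

theorem dx_tmul_one_mul_metricForm (P : Matrix (Fin n) (Fin n) ℝ) (j : Fin n) :
    (dx j ⊗ₜ[ℝ] (1 : Forms n)) * metricForm P = -(metricForm P * (dx j ⊗ₜ[ℝ] (1 : Forms n))) := by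
  simp only [metricForm, Finset.mul_sum, Finset.sum_mul, ← Finset.sum_neg_distrib, mul_smul_comm,
    smul_mul_assoc, Algebra.TensorProduct.tmul_mul_tmul, one_mul, mul_one, ← smul_neg,
    ← TensorProduct.neg_tmul, ← dx_mul_dx_comm]

theorem one_tmul_dx_mul_metricForm (P : Matrix (Fin n) (Fin n) ℝ) (j : Fin n) :
    ((1 : Forms n) ⊗ₜ[ℝ] dx j) * metricForm P = -(metricForm P * ((1 : Forms n) ⊗ₜ[ℝ] dx j)) := by
  simp only [metricForm, Finset.mul_sum, Finset.sum_mul, ← Finset.sum_neg_distrib, mul_smul_comm,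
    smul_mul_assoc, Algebra.TensorProduct.tmul_mul_tmul, one_mul, mul_one, ← smul_neg,
    ← TensorProduct.tmul_neg, ← dx_mul_dx_comm]

theorem sum_dx_tmul_one_mul_metricForm_pow {P : Matrix (Fin n) (Fin n) ℝ}
    {β : Fin n → DoubleForm n} (h : ∑ j, (dx j ⊗ₜ[ℝ] (1 : Forms n)) * β j = 0) (m : ℕ) :
    ∑ j, (dx j ⊗ₜ[ℝ] (1 : Forms n)) * (metricForm P ^ m * β j) = 0 := by
  induction m with
  | zero => simpa using h
  | succ m ih =>
    simp only [pow_succ', mul_assoc]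
    simp only [← mul_assoc (_ ⊗ₜ[ℝ] _) (metricForm P), dx_tmul_one_mul_metricForm, neg_mul]
    simp only [mul_assoc, Finset.sum_neg_distrib, ← Finset.mul_sum, ih, mul_zero, neg_zero]

theorem sum_one_tmul_dx_mul_metricForm_pow {P : Matrix (Fin n) (Fin n) ℝ}
    {β : Fin n → DoubleForm n} (h : ∑ j, ((1 : Forms n) ⊗ₜ[ℝ] dx j) * β j = 0) (m : ℕ) :
    ∑ j, ((1 : Forms n) ⊗ₜ[ℝ] dx j) * (metricForm P ^ m * β j) = 0 := by
  induction m with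
  | zero => simpa using h
  | succ m ih =>
    simp only [pow_succ', mul_assoc]
    simp only [← mul_assoc (_ ⊗ₜ[ℝ] _) (metricForm P), one_tmul_dx_mul_metricForm, neg_mul]
    simp only [mul_assoc, Finset.sum_neg_distrib, ← Finset.mul_sum, ih, mul_zero, neg_zero]

/-- The trace `∑ g^{ij} ι_{∂_i} β_j`; for `β_j = ∇_{∂_j} α` it is `-δα`. -/
def divergence (P : Matrix (Fin n) (Fin n) ℝ) (β : Fin n → DoubleForm n) : DoubleForm n :=
  ∑ i, ∑ j, P⁻¹ i j • LinearMap.rTensor (Forms n) (contr i) (β j)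

/-- For `β_j = ∇_{∂_j} α` this reads `δ(g α) = -g δα` if `α` is closed in its second factor. -/
theorem divergence_metricForm_mul {P : Matrix (Fin n) (Fin n) ℝ} (hP : P.IsSymm)
    (hdet : IsUnit P.det) {β : Fin n → DoubleForm n}
    (h : ∑ j, ((1 : Forms n) ⊗ₜ[ℝ] dx j) * β j = 0) :
    divergence P (fun j => metricForm P * β j) = -(metricForm P * divergence P β) := by
  simp only [divergence, rTensor_contr_metricForm_mul, smul_sub, Finset.sum_sub_distrib,
    Finset.mul_sum, mul_smul_comm]
  rw [sub_eq_neg_self]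
  have e : ∀ l j, ∑ i, P⁻¹ i j * P i l = (1 : Matrix (Fin n) (Fin n) ℝ) l j := fun l j => by
    rw [← Matrix.mul_nonsing_inv P hdet, Matrix.mul_apply]
    exact Finset.sum_congr rfl fun i _ => by rw [hP.apply l i, mul_comm]
  rw [Finset.sum_comm, ← h]
  refine Finset.sum_congr rfl fun j _ => ?_
  simp only [Finset.smul_sum, smul_smul]
  rw [Finset.sum_comm]
  simp only [← Finset.sum_smul, e, Matrix.one_apply]
  simp

theorem divergence_metricForm_pow_mul {P : Matrix (Fin n) (Fin n) ℝ} (hP : P.IsSymm)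
    (hdet : IsUnit P.det) {β : Fin n → DoubleForm n}
    (h : ∑ j, ((1 : Forms n) ⊗ₜ[ℝ] dx j) * β j = 0) (m : ℕ) :
    divergence P (fun j => metricForm P ^ m * β j)
      = (-1 : ℝ) ^ m • (metricForm P ^ m * divergence P β) := by
  induction m with
  | zero => simp
  | succ m ih =>
    have := divergence_metricForm_mul hP hdet (sum_one_tmul_dx_mul_metricForm_pow (P := P) h m)
    simp only [pow_succ' (metricForm P), mul_assoc]
    rw [this, ih, mul_smul_comm, pow_succ, mul_neg_one, neg_smul]

theorem mul_ι_eq_ι_mul_involute (a : Forms n) (v : Fin n → ℝ) :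
    a * ExteriorAlgebra.ι ℝ v = ExteriorAlgebra.ι ℝ v * CliffordAlgebra.involute a := by
  induction a using CliffordAlgebra.left_induction with
  | algebraMap r => rw [AlgHom.commutes, Algebra.commutes]
  | add x y hx hy => rw [add_mul, hx, hy, map_add, mul_add]
  | ι_mul x w hx =>
    have h := eq_neg_of_add_eq_zero_left (ExteriorAlgebra.ι_add_mul_swap (R := ℝ) w v)
    simp only [ExteriorAlgebra.ι] at h hx ⊢
    rw [mul_assoc, hx, map_mul, CliffordAlgebra.involute_ι, ← mul_assoc, h, neg_mul, mul_assoc,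
      neg_mul, mul_neg]

theorem sum_mul_dx_tmul_one_eq_zero {β : Fin n → DoubleForm n}
    (h : ∑ j, (dx j ⊗ₜ[ℝ] (1 : Forms n)) * β j = 0) :
    ∑ j, β j * (dx j ⊗ₜ[ℝ] (1 : Forms n)) = 0 := by
  let inv : DoubleForm n →ₐ[ℝ] DoubleForm n :=
    Algebra.TensorProduct.map CliffordAlgebra.involute (AlgHom.id ℝ _)
  have h1 : ∀ (x : DoubleForm n) j, x * (dx j ⊗ₜ[ℝ] (1 : Forms n))
      = -inv ((dx j ⊗ₜ[ℝ] (1 : Forms n)) * x) := by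
    intro x j
    induction x using TensorProduct.induction_on with
    | zero => simp
    | add x y hx hy => rw [add_mul, hx, hy, mul_add, map_add, neg_add]
    | tmul a b =>
      have h2 : CliffordAlgebra.involute (dx j) = -dx j := CliffordAlgebra.involute_ι _
      simp only [inv, Algebra.TensorProduct.tmul_mul_tmul, Algebra.TensorProduct.map_tmul, map_mul,
        h2, neg_mul, TensorProduct.neg_tmul, neg_neg, one_mul, mul_one, AlgHom.id_apply]
      rw [dx, mul_ι_eq_ι_mul_involute]
  simp only [h1, Finset.sum_neg_distrib, ← map_sum, h, map_zero, neg_zero]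

/-- The divergence of the Hodge star of a closed double form vanishes, because
`ι_θ ⋆ β = ⋆ (β ∧ θ)`. -/
theorem divergence_hodgeStar {P : Matrix (Fin n) (Fin n) ℝ} (hP : P.IsSymm)
    {β : Fin n → DoubleForm n} (h : ∑ j, (dx j ⊗ₜ[ℝ] (1 : Forms n)) * β j = 0) :
    divergence P (fun j => hodgeStar P (β j)) = 0 := by
  have h1 : ∀ j (x : DoubleForm n), ∑ i, P⁻¹ i j • LinearMap.rTensor (Forms n) (contr i) x
      = interior P (dx j ⊗ₜ[ℝ] (1 : Forms n)) x := by
    intro j x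
    have h2 : interiorForm P (1 : Forms n) = LinearMap.id := LinearMap.ext (interiorForm_one P)
    have hsymm : ∀ i, P⁻¹ j i = P⁻¹ i j := fun i => by
      have : (P⁻¹).IsSymm := by rw [Matrix.IsSymm, Matrix.transpose_nonsing_inv, hP.eq]
      exact this.apply i j
    rw [interior_tmul, interiorForm_dx, h2]
    have h3 : ∀ f : Module.End ℝ (Forms n),
        TensorProduct.map f LinearMap.id = LinearMap.rTensorHom (Forms n) f := fun _ => rfl
    simp only [h3, map_sum, map_smul, LinearMap.sum_apply, LinearMap.smul_apply, hsymm]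
    rfl
  rw [divergence, Finset.sum_comm]
  simp only [h1, hodgeStar, ← interior_mul]
  rw [← LinearMap.sum_apply, ← map_sum, sum_mul_dx_tmul_one_eq_zero h]
  simp

theorem divergence_mem_bidegree {P : Matrix (Fin n) (Fin n) ℝ} {β : Fin n → DoubleForm n}
    {p q : ℕ} (h : ∀ j, β j ∈ bidegree n (p + 1) q) : divergence P β ∈ bidegree n p q :=
  sum_mem fun i _ => sum_mem fun j _ => Submodule.smul_mem _ _ (rTensor_contr_mem_bidegree (h j) i)

/-! ### Harmonicity -/

/-- If `⋆(g^{r-2k} R^k) = ε g^{r-2k} R^k` on `U` with a constant `ε ≠ 0`, then `R^k` is closed and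
coclosed on `U`. -/
theorem IsLocalMetric.bianchiSum_codiff_eq_zero (hG : IsLocalMetric G U) {r k : ℕ}
    (hn : n = 2 * r) (hk : 2 ≤ 2 * k) (hkr : 2 * k ≤ r) {ε : ℝ} (hε : ε ≠ 0)
    (h : ∀ z ∈ U, hodgeStar (G z) (metricForm (G z) ^ (r - 2 * k) * curvatureForm G z ^ k)
      = ε • (metricForm (G z) ^ (r - 2 * k) * curvatureForm G z ^ k)) (hy : y ∈ U) :
    bianchiSum G (fun z => curvatureForm G z ^ k) y = 0
      ∧ codiff G (fun z => curvatureForm G z ^ k) y = 0 := by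
  obtain ⟨β₀, hβ₀⟩ := hG.exists_hasClosedCovDeriv_curvatureForm hy
  obtain ⟨β, hβ⟩ := hβ₀.exists_pow_curvatureForm k
  have hcov : ∀ j, covDeriv G j (fun z => curvatureForm G z ^ k) y = β j := fun j =>
    (hβ.hasCovDeriv j).covDeriv_eq
  refine ⟨by simp only [bianchiSum, hcov, hβ.closed_left], ?_⟩
  have hcodiff : codiff G (fun z => curvatureForm G z ^ k) y = -divergence (G y) β := by
    simp only [codiff, hcov, divergence]
  rw [hcodiff, neg_eq_zero]
  set m := r - 2 * k with hm
  have hg : ∀ j, HasCovDeriv G j (fun z => metricForm (G z) ^ m * curvatureForm G z ^ k)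
      (metricForm (G y) ^ m * β j) y := fun j =>
    hG.hasCovDeriv_metricForm_pow_mul hy (hβ.hasCovDeriv j) m
  -- both sides of the (anti-)self-duality can be differentiated covariantly
  have hstar : ∀ j, hodgeStar (G y) (metricForm (G y) ^ m * β j)
      = ε • (metricForm (G y) ^ m * β j) := fun j => by
    refine (hG.hasCovDeriv_hodgeStar hy (hg j)).unique
      (((hg j).const_smul ε).congr_of_eventuallyEq ?_)
    filter_upwards [hG.isOpen.mem_nhds hy] with z hz using h z hz
  have hdiv : divergence (G y) (fun j => metricForm (G y) ^ m * β j) = 0 := by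
    have h1 := divergence_hodgeStar (hG.isSymm y hy)
      (sum_dx_tmul_one_mul_metricForm_pow (P := G y) hβ.closed_left m)
    simp only [hstar] at h1
    have h2 : divergence (G y) (fun j => ε • (metricForm (G y) ^ m * β j))
        = ε • divergence (G y) (fun j => metricForm (G y) ^ m * β j) := by
      simp only [divergence, map_smul, Finset.smul_sum, smul_comm ε]
    rw [h2] at h1
    exact (smul_eq_zero.1 h1).resolve_left hε
  rw [divergence_metricForm_pow_mul (hG.isSymm y hy) (hG.isUnit_det y hy) hβ.closed_right] at hdiv
  -- a covariant derivative of a field of bidegree `(2k, 2k)` has the same bidegree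
  have hβmem : ∀ j, β j ∈ bidegree n (2 * k - 1 + 1) (2 * k) := fun j => by
    have hmem : ∀ z, curvatureForm G z ^ k ∈ bidegree n (2 * k - 1 + 1) (2 * k) := fun z => by
      rw [Nat.sub_add_cancel (by omega), mul_comm 2 k]
      exact pow_mem_bidegree (curvatureForm_mem_bidegree G z) k
    have h1 := HasPartial.mem (hβ.hasCovDeriv j) (Filter.Eventually.of_forall hmem)
    simpa using sub_mem h1 (doubleDerivation_mem_bidegree (connectionMatrix G j y) (hmem y))
  exact eq_zero_of_metricForm_pow_mul_eq_zero (hG.isSymm y hy) (hG.isUnit_det y hy) (by omega)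
    (divergence_mem_bidegree hβmem) ((smul_eq_zero.1 hdiv).resolve_left (by simp))

end CovariantDerivative

/-! ### The metric in a chart of a manifold -/

section ChartExpression

variable {E M : Type*} [NormedAddCommGroup E] [NormedSpace ℝ E] [TopologicalSpace M]
  [ChartedSpace E M] [IsManifold 𝓘(ℝ, E) ∞ M] {φ : OpenPartialHomeomorph M E}

/-- Coordinate vector fields with constant coefficients are smooth. -/
theorem contMDiffOn_mfderiv_symm (hφ : φ ∈ IsManifold.maximalAtlas 𝓘(ℝ, E) ∞ M) (v : E) :
    ContMDiffOn 𝓘(ℝ, E) 𝓘(ℝ, E).tangent ∞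
      (fun z => (⟨φ.symm z, mfderiv 𝓘(ℝ, E) 𝓘(ℝ, E) φ.symm z v⟩ : TangentBundle 𝓘(ℝ, E) M))
      φ.target := by
  have h1 := (contMDiffOn_symm_of_mem_maximalAtlas hφ).contMDiffOn_tangentMapWithin (m := ∞)
    (by simp) φ.open_target.uniqueMDiffOn
  have h2 : ContMDiff 𝓘(ℝ, E) 𝓘(ℝ, E).tangent ∞ (fun z : E =>
      (⟨z, (v : TangentSpace 𝓘(ℝ, E) z)⟩ : TangentBundle 𝓘(ℝ, E) E)) :=
    contMDiff_vectorSpace_iff_contDiff.2 contDiff_const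
  refine (h1.comp h2.contMDiffOn (fun z hz => hz)).congr fun z hz => ?_
  simp only [Function.comp, tangentMapWithin]
  rw [mfderivWithin_of_isOpen φ.open_target hz]

theorem contDiffOn_inner_mfderiv_symm
    (g : Bundle.ContMDiffRiemannianMetric 𝓘(ℝ, E) ∞ E (fun x : M => TangentSpace 𝓘(ℝ, E) x))
    (hφ : φ ∈ IsManifold.maximalAtlas 𝓘(ℝ, E) ∞ M) (v w : E) :
    ContDiffOn ℝ ∞ (fun z => g.inner (φ.symm z) (mfderiv 𝓘(ℝ, E) 𝓘(ℝ, E) φ.symm z v)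
      (mfderiv 𝓘(ℝ, E) 𝓘(ℝ, E) φ.symm z w)) φ.target := by
  rw [← contMDiffOn_iff_contDiffOn]
  intro y hy
  have h0 : ContMDiffOn 𝓘(ℝ, E) (𝓘(ℝ, E).prod 𝓘(ℝ, E →L[ℝ] E →L[ℝ] ℝ)) ∞
      (fun z => Bundle.TotalSpace.mk' (E →L[ℝ] E →L[ℝ] ℝ)
        (E := fun x : M => TangentSpace 𝓘(ℝ, E) x →L[ℝ] TangentSpace 𝓘(ℝ, E) x →L[ℝ] ℝ)
        (φ.symm z) (g.inner (φ.symm z))) φ.target :=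
    (g.contMDiff.contMDiffOn (s := Set.univ)).comp
      (contMDiffOn_symm_of_mem_maximalAtlas hφ) (fun _ _ => trivial)
  have h1 := ContMDiffOn.clm_bundle_apply₂ (F₁ := E) (F₂ := E) (F₃ := ℝ)
    (E₃ := Bundle.Trivial M ℝ) h0 (contMDiffOn_mfderiv_symm hφ v)
    (contMDiffOn_mfderiv_symm hφ w) y hy
  rw [Bundle.contMDiffWithinAt_totalSpace] at h1
  exact h1.2

omit [IsManifold 𝓘(ℝ, E) ∞ M] in
theorem mfderiv_symm_injective (hφ : φ ∈ IsManifold.maximalAtlas 𝓘(ℝ, E) ∞ M) {y : E}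
    (hy : y ∈ φ.target) : Function.Injective (mfderiv 𝓘(ℝ, E) 𝓘(ℝ, E) φ.symm y) := by
  have hd : MDifferentiableAt 𝓘(ℝ, E) 𝓘(ℝ, E) φ.symm y :=
    (contMDiffAt_symm_of_mem_maximalAtlas hφ hy).mdifferentiableAt (by simp)
  have hd' : MDifferentiableAt 𝓘(ℝ, E) 𝓘(ℝ, E) φ (φ.symm y) :=
    (contMDiffAt_of_mem_maximalAtlas hφ (φ.map_target hy)).mdifferentiableAt (by simp)
  have hcomp := mfderiv_comp y hd' hd
  have hid : mfderiv 𝓘(ℝ, E) 𝓘(ℝ, E) (φ ∘ φ.symm) y = mfderiv 𝓘(ℝ, E) 𝓘(ℝ, E) id y := by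
    apply Filter.EventuallyEq.mfderiv_eq
    filter_upwards [φ.open_target.mem_nhds hy] with z hz
    simp [φ.right_inv hz]
  rw [hid, mfderiv_id] at hcomp
  refine Function.LeftInverse.injective (g := mfderiv 𝓘(ℝ, E) 𝓘(ℝ, E) φ (φ.symm y)) fun w => ?_
  exact (congrArg (fun T : E →L[ℝ] E => T w) hcomp).symm

end ChartExpression

variable {M : Type*} [TopologicalSpace M] [ChartedSpace (EuclideanSpace ℝ (Fin n)) M]
  [IsManifold (𝓡 n) ∞ M]

theorem contDiffOn_gram (g : RiemMetric n M)
    {φ : OpenPartialHomeomorph M (EuclideanSpace ℝ (Fin n))}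
    (hφ : φ ∈ IsManifold.maximalAtlas (𝓡 n) ∞ M) (i j : Fin n) :
    ContDiffOn ℝ ∞ (fun z => gram g φ z i j) φ.target :=
  contDiffOn_inner_mfderiv_symm g hφ _ _

theorem gram_isSymm (g : RiemMetric n M) (φ : OpenPartialHomeomorph M (EuclideanSpace ℝ (Fin n)))
    (y : EuclideanSpace ℝ (Fin n)) : (gram g φ y).IsSymm :=
  Matrix.IsSymm.ext fun _ _ => g.symm _ _ _

/-- The matrix of a positive definite form in the frame `∂_i`, which is linearly independent because
the differential of the inverse of a chart is injective, is invertible. -/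
theorem isUnit_det_gram (g : RiemMetric n M)
    {φ : OpenPartialHomeomorph M (EuclideanSpace ℝ (Fin n))}
    (hφ : φ ∈ IsManifold.maximalAtlas (𝓡 n) ∞ M) {y : EuclideanSpace ℝ (Fin n)}
    (hy : y ∈ φ.target) : IsUnit (gram g φ y).det := by
  rw [isUnit_iff_ne_zero]
  intro h0
  obtain ⟨v, hv, hGv⟩ := Matrix.exists_mulVec_eq_zero_iff.2 h0
  let L : EuclideanSpace ℝ (Fin n) →L[ℝ] TangentSpace (𝓡 n) (φ.symm y) :=
    mfderiv (𝓡 n) (𝓡 n) φ.symm y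
  have hinj : Function.Injective L := mfderiv_symm_injective hφ hy
  let w : EuclideanSpace ℝ (Fin n) := ∑ i, v i • EuclideanSpace.single i (1 : ℝ)
  have hw : w ≠ 0 := fun hw => hv <| by
    ext i
    simpa [w, Pi.single_apply] using congrArg (fun x : EuclideanSpace ℝ (Fin n) => x i) hw
  have hpos := g.pos (φ.symm y) (L w) fun h => hw (hinj (h.trans (map_zero L).symm))
  have hLw : L w = ∑ i, v i • L (EuclideanSpace.single i (1 : ℝ)) := by
    simp only [w, map_sum, map_smul]
  have : g.inner (φ.symm y) (L w) (L w) = v ⬝ᵥ (gram g φ y).mulVec v := by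
    rw [hLw]
    simp only [map_sum, map_smul, dotProduct, Matrix.mulVec, gram, Finset.mul_sum,
      smul_eq_mul, sum_apply, smul_apply]
    refine Finset.sum_congr rfl fun i _ => ?_
    refine Finset.sum_congr rfl fun j _ => ?_
    rw [g.symm, mul_comm (v j)]
    rfl
  rw [this, hGv, dotProduct_zero] at hpos
  exact lt_irrefl _ hpos

theorem isLocalMetric_gram (g : RiemMetric n M)
    {φ : OpenPartialHomeomorph M (EuclideanSpace ℝ (Fin n))}
    (hφ : φ ∈ IsManifold.maximalAtlas (𝓡 n) ∞ M) : IsLocalMetric (gram g φ) φ.target where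
  isOpen := φ.open_target
  smooth := contDiffOn_gram g hφ
  isSymm y _ := gram_isSymm g φ y
  isUnit_det _ hy := isUnit_det_gram g hφ hy

end ThorpeGeometry

end

theorem mainTheorem3 {n : ℕ} {M : Type*} [TopologicalSpace M]
    [ChartedSpace (EuclideanSpace ℝ (Fin n)) M] [IsManifold (𝓡 n) ∞ M]
    (g : ThorpeGeometry.RiemMetric n M) (r k : ℕ) (hn : n = 2 * r)
    (hk : 2 ≤ 2 * k) (hkr : 2 * k ≤ r)
    (h : ThorpeGeometry.IsThorpe g r k ∨ ThorpeGeometry.IsAntiThorpe g r k) :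
    ThorpeGeometry.IsHarmonic g (ThorpeGeometry.thorpeTensor g k) := by
  -- the sign `ε` treats the Thorpe and the anti-Thorpe condition together
  have key : ∀ ε : ℝ, ε ≠ 0 → (∀ φ ∈ IsManifold.maximalAtlas (𝓡 n) ∞ M, ∀ y ∈ φ.target,
      ThorpeGeometry.hodgeStar (ThorpeGeometry.gram g φ y)
          (ThorpeGeometry.metricForm (ThorpeGeometry.gram g φ y) ^ (r - 2 * k)
            * ThorpeGeometry.thorpeTensor g k φ y)
        = ε • (ThorpeGeometry.metricForm (ThorpeGeometry.gram g φ y) ^ (r - 2 * k)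
            * ThorpeGeometry.thorpeTensor g k φ y)) →
      ThorpeGeometry.IsHarmonic g (ThorpeGeometry.thorpeTensor g k) :=
    fun ε hε h φ hφ y hy =>
      (ThorpeGeometry.isLocalMetric_gram g hφ).bianchiSum_codiff_eq_zero hn hk hkr hε (h φ hφ) hy
  rcases h with h | h
  · exact key 1 one_ne_zero fun φ hφ y hy => by rw [one_smul]; exact h φ hφ y hy
  · exact key (-1) (neg_ne_zero.2 one_ne_zero) fun φ hφ y hy => by
      rw [neg_one_smul]; exact h φ hφ y hy
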